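/- **Setting.** All vector spaces are complex and $n,m,r$ range over the positive integers. A *matrix order unit space* $(A,1)$ is a $*$-vector space $A$ with proper convex cones $M_n(A)^+\subseteq M_n(A)_{sa}$ (one for each $n$) such that $\gamma^*M_n(A)^+\gamma\subseteq M_m(A)^+$ for all scalar $n\times m$ matrices $\gamma$, the element $1$ is an order unit for $A^+=M_1(A)^+$, and every cone $M_n(A)^+$ is Archimedean. Let $1_n\in M_n(A)$ be the diagonal matrix with diagonal entries $1$, and put $$\|a\|_n=\inf\Big\{t\in\mathbb R:\ \begin{bmatrix}t1_n&a\\ a^*&t1_n\end{bmatrix}\in M_{2n}(A)^+\Big\},\qquad a\in M_n(A).$$ Assume that $A$ is complete for $\|\cdot\|_1$. Scalar matrices carry the operator norm. Let $CS_r(A)$ be the set of unital completely positive linear maps $A\to M_r$ (the matrix states), and for $\varphi=[\varphi_{kl}]\in CS_r(A)$ and $a=[a_{ij}]\in M_n(A)$ put $\ll\varphi,a\gg=[\varphi_{kl}(a_{ij})]\in M_{rn}$. A *graded set* $\mathbf S=(S_n)$ is a sequence of subsets $S_n\subseteq M_n(A)$. A *matrix metric set* of $(A,1)$ is a nonempty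 graded set $\mathbf K=(K_n)$ such that each $K_n$ is $\|\cdot\|_n$-compact and closed under $*$; $K_m\oplus K_n\subseteq K_{m+n}$ and $\alpha K_m\beta\subseteq K_n$ for all $m,n$ and all scalar contractions $\alpha\in M_{n,m}$, $\beta\in M_{m,n}$; and for any two distinct $\varphi,\psi\in CS_r(A)$ there are $n$ and $a\in K_n$ with $\ll\varphi,a\gg\ne\ll\psi,a\gg$. For $\varphi,\psi\in CS_r(A)$ put $$D_{K_r}(\varphi,\psi)=\sup\{\|\ll\varphi,a\gg-\ll\psi,a\gg\|:\ a\in K_n,\ n\ge 1\}.$$ **Theorem.** Let $(A,1)$ be a complete matrix order unit space, $\mathbf K=(K_n)$ a matrix metric set of $(A,1)$, and $\mathbf S=(S_n)$ a graded set with $S_n\subseteq M_n(A)$. The following are equivalent. 1. $\mathbf S$ is norm relatively compact: for every $n$, the $\|\cdot\|_n$-closure of $S_n$ in $M_n(A)$ is $\|\cdot\|_n$-compact. 2. For every $n$, the set $\hat S_n=\{\hat a: a\in S_n\}$ of the maps $\hat a=(\hat a_r)$, $\hat a_r(\varphi)=\ll\varphi,a\gg$ for $\varphi\in CS_r(A)$,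 is bounded and equicontinuous. That is, there is $C>0$ with $\|\hat a_r(\varphi)\|\le C$ for all $a\in S_n$, all $r$ and all $\varphi\in CS_r(A)$; and for every $\epsilon>0$, every $r$ and every $\varphi\in CS_r(A)$ there is $\delta>0$ such that $\|\hat a_r(\varphi)-\hat a_r(\psi)\|<\epsilon$ for all $a\in S_n$ and all $\psi\in CS_r(A)$ with $D_{K_r}(\varphi,\psi)<\delta$. 3. $\mathbf S$ is bounded (each $S_n$ is $\|\cdot\|_n$-bounded), and for every $\epsilon>0$ there is a sequence $(\lambda_n)$ with $\lambda_n>0$ such that for every $n$ $$S_n\subseteq\{a\in M_n(A):\|a\|_n\le\epsilon\}+\lambda_nK_n+M_n(\mathbb C1).$$ -/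

import Mathlib

open scoped ENNReal Matrix Pointwise ComplexOrder

-- Norms of scalar matrices are operator norms between Euclidean (`ℓ²`) spaces.
open scoped Matrix.Norms.L2Operator

noncomputable section

namespace MatrixMetric

/-- `M_n(V)`, for `n = 1, 2, 3, …`. -/
abbrev Mat (n : ℕ+) (V : Type*) := Matrix (Fin n) (Fin n) V

/-- A graded set `S = (S_n)` with `S_n ⊆ M_n(V)`, for `n = 1, 2, 3, …`. -/
abbrev GradedSet (V : Type*) := (n : ℕ+) → Set (Mat n V)

/-- The identification of the index set of `M_{m+n}` with the disjoint union of those of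
`M_m` and `M_n`. -/
def sumIdx (m n : ℕ+) : Fin (m : ℕ) ⊕ Fin (n : ℕ) ≃ Fin ((m + n : ℕ+) : ℕ) :=
  finSumFinEquiv.trans (finCongr (PNat.add_coe m n).symm)

/-- The block matrix `[[a, b], [c, d]]` in `M_{m+n}(V)`. -/
def blocks {V : Type*} {m n : ℕ+} (a : Mat m V) (b : Matrix (Fin m) (Fin n) V)
    (c : Matrix (Fin n) (Fin m) V) (d : Mat n V) : Mat (m + n) V :=
  Matrix.reindex (sumIdx m n) (sumIdx m n) (Matrix.fromBlocks a b c d)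

/-- The direct sum `v ⊕ w`. -/
def directSum {V : Type*} [Zero V] {m n : ℕ+} (v : Mat m V) (w : Mat n V) : Mat (m + n) V :=
  blocks v 0 0 w

/-- The product `α v β = [∑_{k,l} α_{ik} v_{kl} β_{lj}]` of a matrix over `V` with scalar
matrices. -/
def sandwich {V : Type*} [AddCommGroup V] [Module ℂ V] {m n : ℕ+}
    (α : Matrix (Fin n) (Fin m) ℂ) (v : Mat m V) (β : Matrix (Fin m) (Fin n) ℂ) : Mat n V :=
  Matrix.of fun i j => ∑ k, ∑ l, (α i k * β l j) • v k l

/-- The `1 × 1` matrix with entry `a`. -/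
def single {V : Type*} (a : V) : Mat 1 V := Matrix.of fun _ _ => a

/-- A matrix order unit space structure on a complex `*`-vector space `A`: proper cones
`M_n(A)⁺` of self-adjoint matrices (so that each `M_n(A)` is partially ordered), compatible with
compression by rectangular scalar matrices, an order unit `1` for `A⁺`, and all the cones
Archimedean. -/
structure MatrixOrderUnitSpace (A : Type*) [AddCommGroup A] [Module ℂ A] [StarAddMonoid A]
    [StarModule ℂ A] where
  /-- The cone `M_n(A)⁺`. -/
  cone : GradedSet A
  /-- The distinguished order unit. -/
  one : A
  selfAdjoint_of_mem : ∀ {n : ℕ+} {a : Mat n A}, a ∈ cone n → aᴴ = a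
  zero_mem : ∀ n : ℕ+, (0 : Mat n A) ∈ cone n
  add_mem : ∀ {n : ℕ+} {a b : Mat n A}, a ∈ cone n → b ∈ cone n → a + b ∈ cone n
  smul_mem : ∀ {n : ℕ+} {a : Mat n A} {t : ℝ}, 0 ≤ t → a ∈ cone n → (t : ℂ) • a ∈ cone n
  proper : ∀ {n : ℕ+} {a : Mat n A}, a ∈ cone n → -a ∈ cone n → a = 0
  compress : ∀ {m n : ℕ+} (γ : Matrix (Fin n) (Fin m) ℂ) {a : Mat n A},
    a ∈ cone n → sandwich γᴴ a γ ∈ cone m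
  order_unit : ∀ a : A, star a = a → ∃ t : ℝ, 0 < t ∧ single ((t : ℂ) • one - a) ∈ cone 1
  archimedean : ∀ {n : ℕ+} {a b : Mat n A}, b ∈ cone n →
    (∀ t : ℝ, 0 < t → a + (t : ℂ) • b ∈ cone n) → a ∈ cone n

/-- A graded set is absolutely matrix convex if `B_m ⊕ B_n ⊆ B_{m+n}` and `α B_m β ⊆ B_n` for
all contractions `α ∈ M_{n,m}` and `β ∈ M_{m,n}`. -/
structure IsAbsolutelyMatrixConvex {V : Type*} [AddCommGroup V] [Module ℂ V]
    (B : GradedSet V) : Prop where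
  directSum_mem : ∀ {m n : ℕ+} {v : Mat m V} {w : Mat n V},
    v ∈ B m → w ∈ B n → directSum v w ∈ B (m + n)
  sandwich_mem : ∀ {m n : ℕ+} {α : Matrix (Fin n) (Fin m) ℂ} {β : Matrix (Fin m) (Fin n) ℂ}
    {v : Mat m V}, ‖α‖ ≤ 1 → ‖β‖ ≤ 1 → v ∈ B m → sandwich α v β ∈ B n

/-- The matrix pairing `≪φ, a≫ = [φ_{kl}(a_{ij})]` of a linear map `φ = [φ_{kl}] : A → M_r` with
`a = [a_{ij}] ∈ M_n(A)`, an element of `M_r(M_n) = M_{rn}`. Up to the canonical permutation of the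
indices, it is the amplification `[φ(a_{ij})] ∈ M_n(M_r)`. -/
def pairing {A : Type*} [AddCommGroup A] [Module ℂ A] {r n : ℕ+}
    (φ : A →ₗ[ℂ] Mat r ℂ) (a : Mat n A) : Matrix (Fin r × Fin n) (Fin r × Fin n) ℂ :=
  Matrix.of fun p q => φ (a p.2 q.2) p.1 q.1

/-- A matrix mapping `f = (f_r)` from a graded set `(Y_r)` into `(M_r(M_n))_r`. -/
abbrev MatrixMapping (Y : ℕ+ → Type*) (n : ℕ+) :=
  (r : ℕ+) → Y r → Matrix (Fin r × Fin n) (Fin r × Fin n) ℂ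

/-- A set `F` of matrix mappings is bounded: there is a bound `C` for
`sup {‖f_r(w)‖ : w ∈ Y_r, r = 1, 2, …}` that is common to all `f ∈ F`. -/
def IsBoundedFamily {Y : ℕ+ → Type*} {n : ℕ+} (F : Set (MatrixMapping Y n)) : Prop :=
  ∃ C : ℝ, 0 < C ∧ ∀ f ∈ F, ∀ (r : ℕ+) (w : Y r), ‖f r w‖ ≤ C

/-- Equicontinuity of a set `F` of matrix mappings, for the matrix metric `D = (D_r)` on the
domain and the matrix metric induced by the matrix norm of `M_n` on `(M_r(M_n))_r`. -/
def IsEquicontinuousFamily {Y : ℕ+ → Type*} {n : ℕ+} (D : (r : ℕ+) → Y r → Y r → ℝ≥0∞)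
    (F : Set (MatrixMapping Y n)) : Prop :=
  ∀ ε : ℝ, 0 < ε → ∀ (r : ℕ+) (v : Y r), ∃ δ : ℝ, 0 < δ ∧
    ∀ f ∈ F, ∀ w : Y r, D r v w < ENNReal.ofReal δ → ‖f r v - f r w‖ < ε

namespace MatrixOrderUnitSpace

variable {A : Type*} [AddCommGroup A] [Module ℂ A] [StarAddMonoid A] [StarModule ℂ A]

/-- The matrix `[α_{ij} 1] ∈ M_n(ℂ1)` for a scalar matrix `α`. -/
def scalarMat (X : MatrixOrderUnitSpace A) {n : ℕ+} (α : Mat n ℂ) : Mat n A :=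
  α.map fun z => z • X.one

/-- The graded set `ℂ1 = (M_n(ℂ1))`. -/
def scalars (X : MatrixOrderUnitSpace A) : GradedSet A := fun n =>
  Set.range fun α : Mat n ℂ => X.scalarMat α

/-- The norm `‖a‖_n = inf {t : [[t1_n, a], [a*, t1_n]] ≥ 0}` on `M_n(A)` determined by the
matrix order. -/
def matNorm (X : MatrixOrderUnitSpace A) {n : ℕ+} (a : Mat n A) : ℝ :=
  sInf {t : ℝ | blocks ((t : ℂ) • X.scalarMat (1 : Mat n ℂ)) a aᴴ
    ((t : ℂ) • X.scalarMat (1 : Mat n ℂ)) ∈ X.cone (n + n)}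

/-- The graded set of closed balls `A_ε = ({a ∈ M_n(A) : ‖a‖_n ≤ ε})`. -/
def closedBall (X : MatrixOrderUnitSpace A) (ε : ℝ) : GradedSet A := fun _ =>
  {a | X.matNorm a ≤ ε}

/-- The norm topology of `M_n(A)`: a set is open if it contains a ball around each of its
points. -/
@[reducible] def normTopology (X : MatrixOrderUnitSpace A) (n : ℕ+) : TopologicalSpace (Mat n A) where
  IsOpen U := ∀ a ∈ U, ∃ ε : ℝ, 0 < ε ∧ ∀ b : Mat n A, X.matNorm (b - a) < ε → b ∈ U
  isOpen_univ := fun _ _ => ⟨1, one_pos, fun _ _ => trivial⟩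
  isOpen_inter := by
    intro U V hU hV a ha
    obtain ⟨ε, hε, h⟩ := hU a ha.1
    obtain ⟨δ, hδ, h'⟩ := hV a ha.2
    exact ⟨min ε δ, lt_min hε hδ, fun b hb =>
      ⟨h b (lt_of_lt_of_le hb (min_le_left _ _)), h' b (lt_of_lt_of_le hb (min_le_right _ _))⟩⟩
  isOpen_sUnion := by
    intro s hs a ha
    obtain ⟨U, hU, haU⟩ := ha
    obtain ⟨ε, hε, h⟩ := hs U hU a haU
    exact ⟨ε, hε, fun b hb => ⟨U, hU, h b hb⟩⟩

/-- `A` is complete: every Cauchy sequence for the norm `‖·‖ = ‖·‖_1` of `A` converges. -/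
def IsComplete (X : MatrixOrderUnitSpace A) : Prop :=
  ∀ u : ℕ → A,
    (∀ ε : ℝ, 0 < ε → ∃ N : ℕ, ∀ i ≥ N, ∀ j ≥ N, X.matNorm (single (u i - u j)) < ε) →
    ∃ a : A, ∀ ε : ℝ, 0 < ε → ∃ N : ℕ, ∀ i ≥ N, X.matNorm (single (u i - a)) < ε

/-- A graded set is norm compact if each of its members is. -/
def IsNormCompact (X : MatrixOrderUnitSpace A) (S : GradedSet A) : Prop :=
  ∀ n : ℕ+, @IsCompact (Mat n A) (X.normTopology n) (S n)

/-- A graded set is norm relatively compact if each of its members has compact closure. -/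
def IsNormRelativelyCompact (X : MatrixOrderUnitSpace A) (S : GradedSet A) : Prop :=
  ∀ n : ℕ+, @IsCompact (Mat n A) (X.normTopology n) (@closure (Mat n A) (X.normTopology n) (S n))

/-- A graded set is bounded if each of its members is norm bounded. -/
def IsNormBounded (X : MatrixOrderUnitSpace A) (S : GradedSet A) : Prop :=
  ∀ n : ℕ+, ∃ C : ℝ, ∀ a ∈ S n, X.matNorm a ≤ C

/-- `φ` is a unital completely positive linear map from `A` into `M_r`. -/
structure IsMatrixState (X : MatrixOrderUnitSpace A) {r : ℕ+} (φ : A →ₗ[ℂ] Mat r ℂ) : Prop where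
  unital : φ X.one = 1
  completelyPositive : ∀ (n : ℕ+) (a : Mat n A), a ∈ X.cone n → (pairing φ a).PosSemidef

/-- The matrix state space `CS(A) = (CS_r(A))`. -/
def CS (X : MatrixOrderUnitSpace A) (r : ℕ+) : Type _ :=
  {φ : A →ₗ[ℂ] Mat r ℂ // X.IsMatrixState φ}

/-- A matrix metric set of `(A, 1)`: a (nonempty) graded set that is norm compact, self-adjoint,
absolutely matrix convex, and separates the matrix states. -/
structure IsMatrixMetricSet (X : MatrixOrderUnitSpace A) (K : GradedSet A) : Prop where
  nonempty : ∃ n : ℕ+, (K n).Nonempty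
  normCompact : X.IsNormCompact K
  selfAdjoint : ∀ {n : ℕ+} {a : Mat n A}, a ∈ K n → aᴴ ∈ K n
  absolutelyMatrixConvex : IsAbsolutelyMatrixConvex K
  separates : ∀ {r : ℕ+} {φ ψ : X.CS r}, φ ≠ ψ →
    ∃ n : ℕ+, ∃ a ∈ K n, pairing φ.1 a ≠ pairing ψ.1 a

/-- The matrix metric `D_K = (D_{K_r})` on `CS(A)`,
`D_{K_r}(φ, ψ) = sup {‖≪φ, a≫ - ≪ψ, a≫‖ : a ∈ K_n, n = 1, 2, …}`, with the supremum taken in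
`[0, ∞]`. -/
def stateDist (X : MatrixOrderUnitSpace A) (K : GradedSet A) (r : ℕ+) (φ ψ : X.CS r) : ℝ≥0∞ :=
  ⨆ (n : ℕ+) (a ∈ K n), ENNReal.ofReal ‖pairing φ.1 a - pairing ψ.1 a‖

/-- The matrix mapping `â = (â_r)` on `CS(A)`, `â_r(φ) = ≪φ, a≫`. -/
def hat (X : MatrixOrderUnitSpace A) {n : ℕ+} (a : Mat n A) : MatrixMapping X.CS n :=
  fun _ φ => pairing φ.1 a

/-- The set `Ŝ_n = {â : a ∈ S_n}`. -/
def hatSet (X : MatrixOrderUnitSpace A) (S : GradedSet A) (n : ℕ+) : Set (MatrixMapping X.CS n) :=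
  X.hat '' S n

end MatrixOrderUnitSpace

end MatrixMetric

end

/-! Condition 1 is total boundedness of each `S n`: since `A` is complete, so is `M_n(A)`, and
finite nets give a compact closure (`isCompact_closure_iff`). The proof runs 1 → 3 → 2 → 1, and
scalar-valued states carry most of it.

1 → 3. The span of `K n` and the scalar matrices is dense in `M_n(A)` (`exists_mem_lipschitz`).
Replace the points of a finite net by nearby elements of that span; finitely many points need only
one scale `lam`. Density is a Hahn–Banach argument at level one (`exists_bound_sub_of_selfAdjoint`):
a self-adjoint element away from a self-adjoint subspace containing `1` yields two states that agree
on the subspace but not at that element, whereas `K` separates states.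

3 → 2. Matrix states are contractive (`IsMatrixState.norm_pairing_le`) and agree on scalar matrices.
Hence, when `a = x + lam k + scalar`, the values of `a` at two states differ by at most `2‖x‖` plus
`lam` times their distance.

2 → 1. This is Arzelà–Ascoli on the scalar state space, which is compact for pointwise convergence
(`isCompact_stateSet`). Total boundedness of `K 1` makes each metric ball around a state contain a
pointwise neighbourhood of it (`exists_mem_nhds_stateDist_lt`). Equicontinuity and a finite subcover
therefore reduce uniform approximation over all states to finitely many of them, where boundedness
gives finite nets. Finally, values at scalar states control the norm of `M_n(A)` up to a factor
depending only on `n` (`matNorm_le_of_forall_state`). -/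

open scoped ComplexStarModule

set_option linter.unusedSectionVars false

namespace MatrixMetric

/-! ### Products of matrices over a vector space with scalar matrices -/

section Sand

variable {V : Type*} [AddCommGroup V] [Module ℂ V]
  {ι ι' κ κ' μ μ' : Type*} [Fintype ι] [Fintype ι']

/-- The product `α v β` of a rectangular matrix over `V` with scalar matrices, for arbitrary
finite index types. -/
def sand (α : Matrix κ ι ℂ) (v : Matrix ι ι' V) (β : Matrix ι' κ' ℂ) : Matrix κ κ' V :=
  Matrix.of fun i j => ∑ k, ∑ l, (α i k * β l j) • v k l

theorem sand_apply (α : Matrix κ ι ℂ) (v : Matrix ι ι' V) (β : Matrix ι' κ' ℂ) (i : κ) (j : κ') :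
    sand α v β i j = ∑ k, ∑ l, (α i k * β l j) • v k l := rfl

theorem sandwich_eq_sand {m n : ℕ+} (α : Matrix (Fin n) (Fin m) ℂ) (v : Mat m V)
    (β : Matrix (Fin m) (Fin n) ℂ) : sandwich α v β = sand α v β := rfl

theorem sand_add (α : Matrix κ ι ℂ) (v w : Matrix ι ι' V) (β : Matrix ι' κ' ℂ) :
    sand α (v + w) β = sand α v β + sand α w β := by
  ext i j
  simp [sand_apply, Finset.sum_add_distrib]

theorem sand_smul (α : Matrix κ ι ℂ) (c : ℂ) (v : Matrix ι ι' V) (β : Matrix ι' κ' ℂ) :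
    sand α (c • v) β = c • sand α v β := by
  ext i j
  simp [sand_apply, Finset.smul_sum, smul_comm c]

theorem sand_smul_left (α : Matrix κ ι ℂ) (c : ℂ) (v : Matrix ι ι' V) (β : Matrix ι' κ' ℂ) :
    sand (c • α) v β = c • sand α v β := by
  ext i j
  simp [sand_apply, Finset.smul_sum, smul_smul, mul_assoc]

theorem sand_smul_right (α : Matrix κ ι ℂ) (c : ℂ) (v : Matrix ι ι' V) (β : Matrix ι' κ' ℂ) :
    sand α v (c • β) = c • sand α v β := by
  ext i j
  simp only [sand_apply, Finset.smul_sum, smul_smul, Matrix.smul_apply, smul_eq_mul]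
  refine Finset.sum_congr rfl fun k _ => Finset.sum_congr rfl fun l _ => ?_
  congr 1
  ring

theorem sand_sand [Fintype κ] [Fintype κ'] (α' : Matrix μ κ ℂ) (α : Matrix κ ι ℂ)
    (v : Matrix ι ι' V) (β : Matrix ι' κ' ℂ) (β' : Matrix κ' μ' ℂ) :
    sand α' (sand α v β) β' = sand (α' * α) v (β * β') := by
  ext i j
  simp only [sand_apply, Matrix.mul_apply, Finset.smul_sum, smul_smul]
  calc ∑ a, ∑ b, ∑ k, ∑ l, (α' i a * β' b j * (α a k * β l b)) • v k l
      = ∑ a, ∑ k, ∑ b, ∑ l, (α' i a * β' b j * (α a k * β l b)) • v k l :=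
        Finset.sum_congr rfl fun a _ => Finset.sum_comm
    _ = ∑ k, ∑ a, ∑ b, ∑ l, (α' i a * β' b j * (α a k * β l b)) • v k l := Finset.sum_comm
    _ = ∑ k, ∑ a, ∑ l, ∑ b, (α' i a * β' b j * (α a k * β l b)) • v k l :=
        Finset.sum_congr rfl fun k _ => Finset.sum_congr rfl fun a _ => Finset.sum_comm
    _ = ∑ k, ∑ l, ∑ a, ∑ b, (α' i a * β' b j * (α a k * β l b)) • v k l :=
        Finset.sum_congr rfl fun k _ => Finset.sum_comm
    _ = _ := Finset.sum_congr rfl fun k _ => Finset.sum_congr rfl fun l _ => by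
        rw [Finset.sum_mul_sum, Finset.sum_smul]
        refine Finset.sum_congr rfl fun a _ => ?_
        rw [Finset.sum_smul]
        refine Finset.sum_congr rfl fun b _ => ?_
        congr 1
        ring

theorem sand_one [DecidableEq ι] [DecidableEq ι'] (v : Matrix ι ι' V) : sand 1 v 1 = v := by
  ext i j
  simp [sand_apply, Matrix.one_apply, ite_smul, Finset.sum_ite_eq]

theorem sand_diag (α : Matrix κ ι ℂ) (β : Matrix ι' κ' ℂ) (a : Matrix ι ι V) (b : Matrix ι ι' V)
    (c : Matrix ι' ι V) (d : Matrix ι' ι' V) :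
    sand (Matrix.fromBlocks αᴴ 0 0 β)ᴴ (Matrix.fromBlocks a b c d) (Matrix.fromBlocks αᴴ 0 0 β) =
      Matrix.fromBlocks (sand α a αᴴ) (sand α b β) (sand βᴴ c αᴴ) (sand βᴴ d β) := by
  ext (i | i) (j | j) <;> simp [sand_apply, Fintype.sum_sum_type]

theorem sand_submatrix_equiv (α : Matrix κ ι ℂ) (v : Matrix ι ι V) (β : Matrix ι κ' ℂ)
    (e : ι' ≃ ι) :
    sand (α.submatrix id e) (v.submatrix e e) (β.submatrix e id) = sand α v β := by
  ext i j
  simp only [sand_apply, Matrix.submatrix_apply, id]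
  rw [← e.sum_comp]
  exact Finset.sum_congr rfl fun k _ => e.sum_comp fun l => (α i (e k) * β l j) • v (e k) l

theorem sand_fromCols_fromRows (α : Matrix κ ι ℂ) (α' : Matrix κ ι' ℂ) (v : Matrix ι ι V)
    (w : Matrix ι' ι' V) (β : Matrix ι κ' ℂ) (β' : Matrix ι' κ' ℂ) :
    sand (Matrix.fromCols α α') (Matrix.fromBlocks v 0 0 w) (Matrix.fromRows β β') =
      sand α v β + sand α' w β' := by
  ext i j
  simp [sand_apply, Fintype.sum_sum_type]

theorem sand_fromCols (α : Matrix ι κ ℂ) (β : Matrix ι κ' ℂ) (v : Matrix ι ι V) :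
    sand (Matrix.fromCols α β)ᴴ v (Matrix.fromCols α β) =
      Matrix.fromBlocks (sand αᴴ v α) (sand αᴴ v β) (sand βᴴ v α) (sand βᴴ v β) := by
  ext (i | i) (j | j) <;> simp [sand_apply]

theorem conjTranspose_sand [StarAddMonoid V] [StarModule ℂ V] (α : Matrix κ ι ℂ)
    (v : Matrix ι ι' V) (β : Matrix ι' κ' ℂ) : (sand α v β)ᴴ = sand βᴴ vᴴ αᴴ := by
  ext i j
  simp only [sand_apply, Matrix.conjTranspose_apply, star_sum, star_smul, star_mul]
  rw [Finset.sum_comm]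

theorem submatrix_eq_sand [DecidableEq ι] (v : Matrix ι ι V) (f : κ → ι) :
    v.submatrix f f =
      sand ((1 : Matrix ι ι ℂ).submatrix id f)ᴴ v ((1 : Matrix ι ι ℂ).submatrix id f) := by
  ext i j
  simp [sand_apply, Matrix.one_apply, ite_smul, Finset.sum_ite_eq, apply_ite]

end Sand

end MatrixMetric

namespace MatrixMetric
namespace MatrixOrderUnitSpace

variable {A : Type*} [AddCommGroup A] [Module ℂ A] [StarAddMonoid A] [StarModule ℂ A]
  {X : MatrixOrderUnitSpace A}

/-! ### Positivity over arbitrary finite index types -/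

section Pos

variable {ι κ : Type*} [Fintype ι] [Fintype κ]

/-- Positivity of a matrix over `A` with an arbitrary finite index type: all its compressions
to matrices indexed by `Fin m` are positive. -/
def PosOn (X : MatrixOrderUnitSpace A) (a : Matrix ι ι A) : Prop :=
  ∀ (m : ℕ+) (γ : Matrix ι (Fin m) ℂ), sand γᴴ a γ ∈ X.cone m

/-- The matrix `[α_{ij} 1]`, for arbitrary index types. -/
def unitMat (X : MatrixOrderUnitSpace A) (α : Matrix ι κ ℂ) : Matrix ι κ A := α.map fun z => z • X.one

theorem posOn_iff_mem_cone {n : ℕ+} {a : Mat n A} : X.PosOn a ↔ a ∈ X.cone n :=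
  ⟨fun h => by simpa [sand_one] using h n 1, fun h _ γ => X.compress γ h⟩

theorem PosOn.add {a b : Matrix ι ι A} (ha : X.PosOn a) (hb : X.PosOn b) : X.PosOn (a + b) :=
  fun m γ => by rw [sand_add]; exact X.add_mem (ha m γ) (hb m γ)

theorem PosOn.smul {a : Matrix ι ι A} (ha : X.PosOn a) {t : ℝ} (ht : 0 ≤ t) :
    X.PosOn ((t : ℂ) • a) :=
  fun m γ => by rw [sand_smul]; exact X.smul_mem ht (ha m γ)

theorem posOn_zero : X.PosOn (0 : Matrix ι ι A) := fun m γ => by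
  convert X.zero_mem m
  ext i j
  simp [sand_apply]

theorem PosOn.sand {a : Matrix ι ι A} (ha : X.PosOn a) (γ : Matrix ι κ ℂ) :
    X.PosOn (sand γᴴ a γ) := fun m δ => by
  rw [sand_sand, ← Matrix.conjTranspose_mul]
  exact ha m _

theorem PosOn.submatrix [DecidableEq ι] {a : Matrix ι ι A} (ha : X.PosOn a) (f : κ → ι) :
    X.PosOn (a.submatrix f f) := by
  rw [submatrix_eq_sand]
  exact ha.sand _

/-- Lets block matrices be handled over sum types, meeting `Fin` indices only at the cones
themselves. -/
theorem posOn_reindex_iff [DecidableEq ι] {n : ℕ+} (e : ι ≃ Fin n) {a : Matrix ι ι A} :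
    Matrix.reindex e e a ∈ X.cone n ↔ X.PosOn a := by
  rw [← posOn_iff_mem_cone]
  refine ⟨fun h => ?_, fun h => h.submatrix _⟩
  simpa using h.submatrix e

theorem unitMat_add (α β : Matrix ι κ ℂ) : X.unitMat (α + β) = X.unitMat α + X.unitMat β := by
  ext i j
  simp [unitMat, add_smul]

theorem unitMat_smul (c : ℂ) (α : Matrix ι κ ℂ) : X.unitMat (c • α) = c • X.unitMat α := by
  ext i j
  simp [unitMat, mul_smul]

theorem unitMat_zero : X.unitMat (0 : Matrix ι κ ℂ) = 0 := by
  ext i j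
  simp [unitMat]

theorem sand_unitMat {ι' κ' : Type*} [Fintype ι'] (α : Matrix κ ι ℂ) (μ : Matrix ι ι' ℂ)
    (β : Matrix ι' κ' ℂ) : MatrixMetric.sand α (X.unitMat μ) β = X.unitMat (α * μ * β) := by
  ext i j
  simp only [sand_apply, unitMat, Matrix.map_apply, smul_smul, Matrix.mul_apply,
    ← Finset.sum_smul, Finset.sum_mul]
  rw [Finset.sum_comm]
  congr 1
  refine Finset.sum_congr rfl fun k _ => Finset.sum_congr rfl fun l _ => ?_
  ring

theorem unitMat_fromBlocks {ι' κ' : Type*} (a : Matrix ι κ ℂ) (b : Matrix ι κ' ℂ)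
    (c : Matrix ι' κ ℂ) (d : Matrix ι' κ' ℂ) :
    X.unitMat (Matrix.fromBlocks a b c d) =
      Matrix.fromBlocks (X.unitMat a) (X.unitMat b) (X.unitMat c) (X.unitMat d) :=
  Matrix.fromBlocks_map _ _ _ _ _

/-- The matrix with entry `a` indexed by the one-point type. -/
def elt (a : A) : Matrix Unit Unit A := Matrix.of fun _ _ => a

@[simp] theorem elt_apply (a : A) (i j : Unit) : elt a i j = a := rfl

theorem single_mem_cone_iff {a : A} : single a ∈ X.cone 1 ↔ X.PosOn (elt a) :=
  posOn_reindex_iff (n := 1) (Equiv.ofUnique Unit (Fin 1)) (a := elt a)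

variable (X) in
theorem posOn_elt_one : X.PosOn (elt X.one) := by
  obtain ⟨t, ht, h⟩ := X.order_unit 0 (star_zero A)
  have := (single_mem_cone_iff.1 h).smul (t := t⁻¹) (by positivity)
  convert this using 1
  ext i j
  simp only [Matrix.smul_apply, elt_apply, sub_zero, smul_smul]
  rw [← Complex.ofReal_mul, inv_mul_cancel₀ ht.ne', Complex.ofReal_one, one_smul]

theorem posOn_sum {σ : Type*} (s : Finset σ) (f : σ → Matrix ι ι A)
    (h : ∀ i ∈ s, X.PosOn (f i)) : X.PosOn (∑ i ∈ s, f i) := by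
  classical
  induction s using Finset.induction_on with
  | empty => simpa using posOn_zero
  | insert i s hi ih =>
    rw [Finset.sum_insert hi]
    exact (h i (by simp)).add (ih fun j hj => h j (by simp [hj]))

/-- A positive semidefinite scalar matrix is a sum of rank-one terms `v v*`, and each of these
becomes a compression of the order unit. -/
theorem posOn_unitMat {P : Matrix ι ι ℂ} (hP : P.PosSemidef) : X.PosOn (X.unitMat P) := by
  obtain ⟨m, v, rfl⟩ := Matrix.posSemidef_iff_eq_sum_vecMulVec.1 hP
  have : X.unitMat (∑ i, Matrix.vecMulVec (v i) (star (v i))) =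
      ∑ i, MatrixMetric.sand (Matrix.of fun (_ : Unit) j => star (v i j))ᴴ (elt X.one)
        (Matrix.of fun (_ : Unit) j => star (v i j)) := by
    ext k l
    simp [unitMat, Matrix.sum_apply, Matrix.vecMulVec_apply, sand_apply, Finset.sum_smul]
  rw [this]
  exact posOn_sum _ _ fun i _ => X.posOn_elt_one.sand _

end Pos

/-! ### Calculus of the order relation behind the norm -/

section Bound

variable {ι κ ι' κ' : Type*} [Fintype ι] [Fintype κ] [Fintype ι'] [Fintype κ'] [DecidableEq ι]
  [DecidableEq κ] [DecidableEq ι'] [DecidableEq κ']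

/-- The relation `[[t1, a], [a*, t1]] ≥ 0` defining the matrix norm. -/
def Bound (X : MatrixOrderUnitSpace A) (t : ℝ) (a : Matrix ι κ A) : Prop :=
  X.PosOn (Matrix.fromBlocks ((t : ℂ) • X.unitMat 1) a aᴴ ((t : ℂ) • X.unitMat 1))

theorem Bound.add {s t : ℝ} {a b : Matrix ι κ A} (ha : X.Bound s a) (hb : X.Bound t b) :
    X.Bound (s + t) (a + b) := by
  have := PosOn.add ha hb
  rwa [Matrix.fromBlocks_add, ← add_smul, ← add_smul, ← Matrix.conjTranspose_add,
    ← Complex.ofReal_add] at this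

theorem bound_of_nonneg_zero {t : ℝ} (ht : 0 ≤ t) : X.Bound t (0 : Matrix ι κ A) := by
  have h := (posOn_unitMat (X := X)
    (Matrix.PosSemidef.one : (1 : Matrix (ι ⊕ κ) (ι ⊕ κ) ℂ).PosSemidef)).smul ht
  rw [← Matrix.fromBlocks_one, unitMat_fromBlocks, Matrix.fromBlocks_smul] at h
  unfold Bound
  convert h using 2 <;> ext <;> simp [unitMat]

theorem Bound.mono {s t : ℝ} {a : Matrix ι κ A} (ha : X.Bound s a) (h : s ≤ t) :
    X.Bound t a := by
  simpa using ha.add (bound_of_nonneg_zero (X := X) (ι := ι) (κ := κ) (sub_nonneg.2 h))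

theorem bound_sum {σ : Type*} (s : Finset σ) (f : σ → Matrix ι κ A) (t : σ → ℝ)
    (h : ∀ i ∈ s, X.Bound (t i) (f i)) : X.Bound (∑ i ∈ s, t i) (∑ i ∈ s, f i) := by
  classical
  induction s using Finset.induction_on with
  | empty => simpa using bound_of_nonneg_zero (X := X) le_rfl
  | insert i s hi ih =>
    rw [Finset.sum_insert hi, Finset.sum_insert hi]
    exact (h i (by simp)).add (ih fun j hj => h j (by simp [hj]))

theorem Bound.smul_nonneg {s t : ℝ} {a : Matrix ι κ A} (ha : X.Bound t a) (hs : 0 ≤ s) :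
    X.Bound (s * t) ((s : ℂ) • a) := by
  have := PosOn.smul ha hs
  rw [Matrix.fromBlocks_smul, smul_smul, smul_smul] at this
  simpa [Bound, Matrix.conjTranspose_smul] using this

theorem star_dotProduct_self (y : ι → ℂ) :
    star y ⬝ᵥ y = ((‖WithLp.toLp 2 y‖ ^ 2 : ℝ) : ℂ) := by
  rw [EuclideanSpace.norm_sq_eq]
  simp [dotProduct, ← Complex.normSq_eq_conj_mul_self, Complex.normSq_eq_norm_sq]

theorem posSemidef_one_sub_conjTranspose_mul_self {α : Matrix κ ι ℂ} (hα : ‖α‖ ≤ 1) :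
    (1 - αᴴ * α).PosSemidef := by
  refine Matrix.PosSemidef.of_dotProduct_mulVec_nonneg (by
    simp [Matrix.IsHermitian, Matrix.conjTranspose_sub, Matrix.conjTranspose_mul]) fun x => ?_
  have h1 := Matrix.l2_opNorm_mulVec α (WithLp.toLp 2 x)
  have h2 : ‖WithLp.toLp 2 (α.mulVec x)‖ ^ 2 ≤ ‖WithLp.toLp 2 x‖ ^ 2 := by
    refine pow_le_pow_left₀ (norm_nonneg _) (h1.trans ?_) 2
    exact mul_le_of_le_one_left (norm_nonneg _) hα
  have h4 : star x ⬝ᵥ (1 - αᴴ * α).mulVec x =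
      star x ⬝ᵥ x - star (α.mulVec x) ⬝ᵥ (α.mulVec x) := by
    rw [Matrix.sub_mulVec, dotProduct_sub, Matrix.one_mulVec, ← Matrix.mulVec_mulVec,
      Matrix.star_mulVec, ← Matrix.dotProduct_mulVec]
  rw [h4, star_dotProduct_self, star_dotProduct_self, ← Complex.ofReal_sub]
  exact_mod_cast sub_nonneg.2 h2

/-- Compressing the block matrix by `αᴴ ⊕ β` leaves `t α αᴴ` and `t βᴴ β` on the diagonal. As `α`
and `β` are contractions, adding the positive defects `t (1 - α αᴴ)` and `t (1 - βᴴ β)` restores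
`t`. -/
theorem Bound.sand {t : ℝ} (ht : 0 ≤ t) {a : Matrix ι κ A} (ha : X.Bound t a)
    {α : Matrix ι' ι ℂ} {β : Matrix κ κ' ℂ} (hα : ‖α‖ ≤ 1) (hβ : ‖β‖ ≤ 1) :
    X.Bound t (sand α a β) := by
  have h1 := PosOn.sand ha (Matrix.fromBlocks αᴴ 0 0 β)
  rw [sand_diag, sand_smul, sand_smul, sand_unitMat, sand_unitMat] at h1
  have h2 : X.PosOn (X.unitMat (Matrix.fromBlocks (1 - α * αᴴ) 0 0 (1 - βᴴ * β))) := by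
    refine posOn_unitMat ?_
    have e1 := posSemidef_one_sub_conjTranspose_mul_self (α := αᴴ)
      (by rwa [Matrix.l2_opNorm_conjTranspose])
    have e2 := posSemidef_one_sub_conjTranspose_mul_self hβ
    rw [Matrix.conjTranspose_conjTranspose] at e1
    refine Matrix.PosSemidef.of_dotProduct_mulVec_nonneg
      (Matrix.IsHermitian.fromBlocks e1.1 (by simp) e2.1) fun x => ?_
    rw [Matrix.fromBlocks_mulVec, Matrix.dotProduct_block]
    simp only [Matrix.zero_mulVec, add_zero, zero_add, Sum.elim_comp_inl, Sum.elim_comp_inr]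
    exact add_nonneg (e1.dotProduct_mulVec_nonneg (x ∘ Sum.inl))
      (e2.dotProduct_mulVec_nonneg (x ∘ Sum.inr))
  have h3 := h1.add (h2.smul ht)
  rw [unitMat_fromBlocks, Matrix.fromBlocks_smul, Matrix.fromBlocks_add, ← smul_add,
    ← smul_add, ← unitMat_add, ← unitMat_add] at h3
  simpa [Bound, conjTranspose_sand, unitMat_zero] using h3

theorem norm_smul_one_le {z : ℂ} (hz : ‖z‖ ≤ 1) : ‖(z • 1 : Matrix ι ι ℂ)‖ ≤ 1 := by
  rw [Matrix.smul_one_eq_diagonal, Matrix.l2_opNorm_diagonal]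
  exact (pi_norm_le_iff_of_nonneg zero_le_one).2 fun _ => hz

theorem Bound.smul_le {t : ℝ} (ht : 0 ≤ t) {a : Matrix ι κ A} (ha : X.Bound t a) {c : ℂ}
    (hc : ‖c‖ ≤ 1) : X.Bound t (c • a) := by
  have h := Bound.sand ht ha (norm_smul_one_le hc) (norm_smul_one_le (ι := κ) (z := 1) (by simp))
  rwa [sand_smul_left, one_smul, sand_one] at h

theorem Bound.smul {t : ℝ} (ht : 0 ≤ t) {a : Matrix ι κ A} (ha : X.Bound t a) (c : ℂ) :
    X.Bound (‖c‖ * t) (c • a) := by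
  by_cases hc : c = 0
  · simpa [hc] using bound_of_nonneg_zero (X := X) le_rfl
  · have h := (Bound.smul_le ht ha (c := c / ‖c‖) (by simp [hc])).smul_nonneg (norm_nonneg c)
    rwa [smul_smul, mul_div_cancel₀] at h
    simpa using hc

/-- The block matrix `[[t, h], [h, t]]` is half the sum of the compression of `t + h` by the row
`(1, 1)` and that of `t - h` by `(1, -1)`. -/
theorem bound_of_posOn {t : ℝ} {h : Matrix ι ι A} (hh : hᴴ = h)
    (h1 : X.PosOn ((t : ℂ) • X.unitMat 1 + h)) (h2 : X.PosOn ((t : ℂ) • X.unitMat 1 - h)) :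
    X.Bound t h := by
  have e1 := (h1.sand (Matrix.fromCols (1 : Matrix ι ι ℂ) (1 : Matrix ι ι ℂ))).add
    (h2.sand (Matrix.fromCols (1 : Matrix ι ι ℂ) (-1 : Matrix ι ι ℂ)))
  have e2 := e1.smul (t := 1 / 2) (by norm_num)
  rw [sand_fromCols, sand_fromCols, ← neg_one_smul ℂ (1 : Matrix ι ι ℂ)] at e2
  simp only [Matrix.conjTranspose_smul, sand_smul_left, sand_smul_right, sand_one,
    Matrix.conjTranspose_one, Matrix.fromBlocks_add, Matrix.fromBlocks_smul] at e2
  unfold Bound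
  convert e2 using 2
  · module
  · module
  · rw [hh, star_neg, star_one]; module
  · rw [star_neg, star_one]; module

end Bound

end MatrixOrderUnitSpace
end MatrixMetric

namespace MatrixMetric
namespace MatrixOrderUnitSpace

variable {A : Type*} [AddCommGroup A] [Module ℂ A] [StarAddMonoid A] [StarModule ℂ A]
  {X : MatrixOrderUnitSpace A}

/-! ### Norm bounds for a matrix and for its entries -/

section Entries

variable {ι κ : Type*} [Fintype ι] [Fintype κ] [DecidableEq ι] [DecidableEq κ]

theorem norm_le_one_of_conjTranspose_mul_self {α : Matrix ι κ ℂ} (h : αᴴ * α = 1) : ‖α‖ ≤ 1 := by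
  have h1 := Matrix.l2_opNorm_conjTranspose_mul_self α
  rw [h] at h1
  have h2 := norm_smul_one_le (ι := κ) (z := 1) (by simp)
  rw [one_smul, h1] at h2
  nlinarith [norm_nonneg α]

theorem norm_col_le_one (σ : Type*) [Fintype σ] [DecidableEq σ] [Unique σ] (i : ι) :
    ‖(Matrix.of fun k (_ : σ) => if k = i then (1 : ℂ) else 0 : Matrix ι σ ℂ)‖ ≤ 1 :=
  norm_le_one_of_conjTranspose_mul_self (by
    ext a b
    rw [Subsingleton.elim a b]
    simp [Matrix.mul_apply])

theorem norm_row_le_one (σ : Type*) [Fintype σ] [DecidableEq σ] [Unique σ] (i : ι) :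
    ‖(Matrix.of fun (_ : σ) k => if k = i then (1 : ℂ) else 0 : Matrix σ ι ℂ)‖ ≤ 1 := by
  rw [← Matrix.l2_opNorm_conjTranspose]
  convert norm_col_le_one σ i
  ext
  simp [Matrix.conjTranspose_apply, apply_ite]

theorem Bound.submatrix {ι' κ' : Type*} [Fintype ι'] [Fintype κ'] [DecidableEq ι']
    [DecidableEq κ'] {t : ℝ} {a : Matrix ι κ A} (h : X.Bound t a) (e : ι' ≃ ι) (f : κ' ≃ κ) :
    X.Bound t (a.submatrix e f) := by
  unfold Bound
  convert PosOn.submatrix h (Sum.map e f) using 1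
  ext (i | i) (j | j) <;> simp [unitMat, Matrix.one_apply]

theorem Bound.entry {t : ℝ} (ht : 0 ≤ t) {a : Matrix ι κ A} (h : X.Bound t a) (i : ι) (j : κ) :
    X.Bound t (elt (a i j)) := by
  convert Bound.sand ht h (norm_row_le_one Unit i) (norm_col_le_one Unit j) using 1
  ext
  simp [sand_apply]

/-- The matrix is a sum of one-entry matrices, each obtained from its entry by contractions. The
constant is crude but depends only on the size. -/
theorem bound_of_entries {a : Matrix ι κ A} {t : ℝ} (ht : 0 ≤ t)
    (h : ∀ i j, X.Bound t (elt (a i j))) : X.Bound (Fintype.card ι * (Fintype.card κ * t)) a := by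
  have h1 := bound_sum (X := X) Finset.univ (fun i => ∑ j, MatrixMetric.sand
    (Matrix.of fun k (_ : Unit) => if k = i then (1 : ℂ) else 0) (elt (a i j))
    (Matrix.of fun (_ : Unit) k => if k = j then (1 : ℂ) else 0)) _ fun i _ =>
      bound_sum Finset.univ _ (fun _ => t) fun j _ =>
        Bound.sand ht (h i j) (norm_col_le_one Unit i) (norm_row_le_one Unit j)
  convert h1 using 1
  · simp
  · ext k l
    simp [sand_apply, Matrix.sum_apply]

theorem bound_elt_of_selfAdjoint {h : A} (hh : star h = h) {t : ℝ}
    (h1 : single ((t : ℂ) • X.one + h) ∈ X.cone 1) (h2 : single ((t : ℂ) • X.one - h) ∈ X.cone 1) :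
    X.Bound t (elt h) := by
  refine bound_of_posOn (by ext; simp [hh]) ?_ ?_
  · convert single_mem_cone_iff.1 h1 using 1
    ext; simp [unitMat]
  · convert single_mem_cone_iff.1 h2 using 1
    ext; simp [unitMat]

theorem bound_elt_of_realPart {x : A} {s t : ℝ} (ht : 0 ≤ t) (h1 : X.Bound s (elt (ℜ x : A)))
    (h2 : X.Bound t (elt (ℑ x : A))) : X.Bound (s + t) (elt x) := by
  convert h1.add (Bound.smul_le ht h2 (c := Complex.I) (by simp)) using 1
  ext
  simp [realPart_add_I_smul_imaginaryPart]

variable (X) in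
theorem exists_single_mem {h : A} (hh : star h = h) :
    ∃ t : ℝ, 0 < t ∧ single ((t : ℂ) • X.one + h) ∈ X.cone 1 ∧
      single ((t : ℂ) • X.one - h) ∈ X.cone 1 := by
  obtain ⟨s, hs, h1⟩ := X.order_unit h hh
  obtain ⟨t, ht, h2⟩ := X.order_unit (-h) (by rw [star_neg, hh])
  refine ⟨s + t, by positivity, ?_, ?_⟩
  · rw [single_mem_cone_iff] at h2 ⊢
    convert h2.add (X.posOn_elt_one.smul hs.le) using 1
    ext
    simp [add_smul]
    abel
  · rw [single_mem_cone_iff] at h1 ⊢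
    convert h1.add (X.posOn_elt_one.smul ht.le) using 1
    ext
    simp [add_smul]
    abel

variable (X) in
theorem exists_bound_elt (x : A) : ∃ t : ℝ, 0 ≤ t ∧ X.Bound t (elt x) := by
  obtain ⟨s, hs, h1, h2⟩ := X.exists_single_mem (h := (ℜ x : A)) (ℜ x).2
  obtain ⟨t, ht, h3, h4⟩ := X.exists_single_mem (h := (ℑ x : A)) (ℑ x).2
  exact ⟨s + t, by positivity, bound_elt_of_realPart ht.le
    (bound_elt_of_selfAdjoint (ℜ x).2 h1 h2) (bound_elt_of_selfAdjoint (ℑ x).2 h3 h4)⟩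

variable (X) in
theorem exists_bound (a : Matrix ι κ A) : ∃ t : ℝ, 0 ≤ t ∧ X.Bound t a := by
  choose t ht h using fun (p : ι × κ) => X.exists_bound_elt (a p.1 p.2)
  have hs : ∀ p, t p ≤ ∑ p, t p := fun p =>
    Finset.single_le_sum (fun q _ => ht q) (Finset.mem_univ p)
  have hn : 0 ≤ ∑ p, t p := Finset.sum_nonneg fun q _ => ht q
  exact ⟨_, by positivity, bound_of_entries hn fun i j => (h (i, j)).mono (hs (i, j))⟩

/-- A negative bound can only hold when `1 = 0`, and then every bound holds. -/
theorem Bound.of_neg [Nonempty ι] {t : ℝ} (ht : t < 0) {a : Matrix ι κ A} (h : X.Bound t a)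
    (s : ℝ) : X.Bound s a := by
  obtain ⟨i⟩ := ‹Nonempty ι›
  have h1 : X.PosOn (elt ((t : ℂ) • X.one)) := by
    convert PosOn.submatrix h (fun _ : Unit => Sum.inl i) using 1
    ext
    simp [unitMat]
  have h2 : X.PosOn (elt (-X.one)) := by
    convert h1.smul (t := (-t)⁻¹) (by rw [inv_nonneg]; linarith) using 1
    ext
    simp only [Matrix.smul_apply, elt_apply, smul_smul, ← Complex.ofReal_mul]
    rw [inv_neg, neg_mul, inv_mul_cancel₀ ht.ne]
    simp
  have h3 := X.proper (single_mem_cone_iff.2 X.posOn_elt_one)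
    (by have := single_mem_cone_iff.2 h2; convert this using 1; ext; rfl)
  have h4 : X.one = 0 := congrFun (congrFun h3 (0 : Fin 1)) (0 : Fin 1)
  have h5 : ∀ c : ℝ, ((c : ℂ) • X.unitMat (1 : Matrix ι ι ℂ)) = 0 := by
    intros; ext; simp [unitMat, h4]
  have h6 : ∀ c : ℝ, ((c : ℂ) • X.unitMat (1 : Matrix κ κ ℂ)) = 0 := by
    intros; ext; simp [unitMat, h4]
  unfold Bound at h ⊢
  rwa [h5, h6] at h ⊢

end Entries

/-! ### The matrix norm as a seminorm -/

section MatNorm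

variable {n : ℕ+}

theorem matNorm_eq (a : Mat n A) : X.matNorm a = sInf {t | X.Bound t a} := by
  unfold matNorm
  congr 1
  ext t
  exact posOn_reindex_iff (sumIdx n n)

theorem matNorm_le {a : Mat n A} {t : ℝ} (ht : 0 ≤ t) (h : X.Bound t a) : X.matNorm a ≤ t := by
  rw [matNorm_eq]
  -- If the set is unbounded below, `sInf` takes the default value `0`, which is where `0 ≤ t` is
  -- needed.
  by_cases hb : BddBelow {t | X.Bound t a}
  · exact csInf_le hb h
  · rwa [Real.sInf_of_not_bddBelow hb]

theorem matNorm_nonneg (a : Mat n A) : 0 ≤ X.matNorm a := by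
  rw [matNorm_eq]
  by_cases h : ∃ t < 0, X.Bound t a
  · obtain ⟨t, ht, h⟩ := h
    rw [show {t | X.Bound t a} = Set.univ from Set.eq_univ_of_forall fun s => h.of_neg ht s]
    simp
  · push Not at h
    exact Real.sInf_nonneg fun t ht => not_lt.1 fun h' => h t h' ht

theorem bound_of_matNorm_lt {a : Mat n A} {t : ℝ} (h : X.matNorm a < t) : X.Bound t a := by
  rw [matNorm_eq] at h
  obtain ⟨s, -, hs⟩ := X.exists_bound a
  obtain ⟨u, hu, hut⟩ := exists_lt_of_csInf_lt ⟨s, hs⟩ h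
  exact Bound.mono hu hut.le

theorem matNorm_le_of_forall_bound {m : ℕ+} {a : Mat n A} {b : Mat m A} {c : ℝ} (hc : 0 ≤ c)
    (h : ∀ t, 0 < t → X.Bound t a → X.Bound (c * t) b) : X.matNorm b ≤ c * X.matNorm a := by
  have h0 := matNorm_nonneg (X := X) a
  have : ∀ t > X.matNorm a, X.matNorm b ≤ c * t := fun t ht =>
    matNorm_le (mul_nonneg hc (h0.trans ht.le)) (h t (h0.trans_lt ht) (bound_of_matNorm_lt ht))
  -- The denominator `c + 1` covers `c = 0`.
  refine le_of_forall_pos_le_add fun ε hε => (this (X.matNorm a + ε / (c + 1))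
    (lt_add_of_pos_right _ (by positivity))).trans ?_
  rw [mul_add]
  gcongr
  rw [mul_div_assoc', div_le_iff₀ (by positivity)]
  nlinarith

theorem matNorm_add_le (a b : Mat n A) : X.matNorm (a + b) ≤ X.matNorm a + X.matNorm b := by
  refine le_of_forall_pos_le_add fun ε hε => ?_
  have h := (bound_of_matNorm_lt (X := X) (a := a) (lt_add_of_pos_right _ (half_pos hε))).add
    (bound_of_matNorm_lt (X := X) (a := b) (lt_add_of_pos_right _ (half_pos hε)))
  have ha := matNorm_nonneg (X := X) a
  have hb := matNorm_nonneg (X := X) b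
  refine (matNorm_le (by positivity) h).trans (by linarith)

theorem matNorm_zero : X.matNorm (0 : Mat n A) = 0 :=
  le_antisymm (matNorm_le le_rfl (bound_of_nonneg_zero le_rfl)) (matNorm_nonneg _)

theorem matNorm_smul_le (c : ℂ) (a : Mat n A) : X.matNorm (c • a) ≤ ‖c‖ * X.matNorm a :=
  matNorm_le_of_forall_bound (norm_nonneg c) fun _ ht h => Bound.smul ht.le h c

theorem matNorm_neg (a : Mat n A) : X.matNorm (-a) = X.matNorm a := by
  have h : ∀ b : Mat n A, X.matNorm (-b) ≤ X.matNorm b := fun b => by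
    simpa using matNorm_smul_le (X := X) (-1) b
  exact le_antisymm (h a) (by simpa using h (-a))

theorem bound_single_iff {x : A} {t : ℝ} : X.Bound t (single x) ↔ X.Bound t (elt x) :=
  let e : Unit ≃ Fin (1 : ℕ+) := Equiv.ofUnique Unit (Fin 1)
  ⟨fun h => h.submatrix e e, fun h => h.submatrix e.symm e.symm⟩

theorem matNorm_entry_le (a : Mat n A) (i j : Fin n) : X.matNorm (single (a i j)) ≤ X.matNorm a := by
  simpa using matNorm_le_of_forall_bound (X := X) (c := 1) zero_le_one fun t ht (h : X.Bound t a) => by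
    rw [one_mul, bound_single_iff]
    exact Bound.entry ht.le h i j

theorem matNorm_le_of_entries {a : Mat n A} {t : ℝ} (ht : 0 ≤ t)
    (h : ∀ i j, X.matNorm (single (a i j)) < t) : X.matNorm a ≤ n * (n * t) := by
  have := bound_of_entries (X := X) ht fun i j => bound_single_iff.1 (bound_of_matNorm_lt (h i j))
  refine matNorm_le (by positivity) ?_
  simpa using this

end MatNorm

end MatrixOrderUnitSpace
end MatrixMetric

/-! ### Separation from a cone with an order unit -/

namespace MatrixMetric

/-- A point that stays outside a cone `C` after a perturbation by a multiple of the order unit `e`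
is separated from `C` by a state. -/
theorem exists_state_neg {E : Type*} [AddCommGroup E] [Module ℝ E] {C : Set E}
    (hadd : ∀ x ∈ C, ∀ y ∈ C, x + y ∈ C) (hsmul : ∀ t : ℝ, 0 ≤ t → ∀ x ∈ C, t • x ∈ C)
    {e : E} (he : e ∈ C) (hunit : ∀ x : E, ∃ t : ℝ, t • e - x ∈ C) {x₀ : E} {ε : ℝ} (hε : 0 < ε)
    (hx₀ : ε • e + x₀ ∉ C) :
    ∃ g : E →ₗ[ℝ] ℝ, (∀ x ∈ C, 0 ≤ g x) ∧ g e = 1 ∧ g x₀ < 0 := by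
  have hzero : (0 : E) ∈ C := by simpa using hsmul 0 le_rfl e he
  have hmono : ∀ {x : E} {s t : ℝ}, s ≤ t → s • e - x ∈ C → t • e - x ∈ C := by
    intro x s t hst hs
    convert hadd _ hs _ (hsmul (t - s) (sub_nonneg.2 hst) e he) using 1
    module
  -- A negative multiple of `e` in `C` could be used to lower a large multiple of `e` to `ε • e`,
  -- forcing `ε • e + x₀` into `C`. This makes the functional `N` below finite.
  have hpos : ∀ {t : ℝ}, t • e ∈ C → 0 ≤ t := by
    intro t ht
    by_contra! h
    obtain ⟨r, hr⟩ := hunit (-x₀)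
    have h1 := hmono (x := -x₀) (le_max_left r ε) hr
    refine hx₀ ?_
    convert hadd _ h1 _ (hsmul ((max r ε - ε) / (-t)) (div_nonneg (sub_nonneg.2 (le_max_right _ _))
      (by linarith)) _ ht) using 1
    rw [smul_smul, div_neg, neg_mul, div_mul_cancel₀ _ h.ne]
    module
  set N : E → ℝ := fun x => sInf {t : ℝ | t • e - x ∈ C} with hN
  have hbdd : ∀ x, BddBelow {t : ℝ | t • e - x ∈ C} := by
    intro x
    obtain ⟨s, hs⟩ := hunit (-x)
    refine ⟨-s, fun t ht => ?_⟩
    have : 0 ≤ s + t := hpos (by convert hadd _ hs _ ht using 1; module)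
    linarith
  have hle : ∀ {x t}, t • e - x ∈ C → N x ≤ t := fun {x t} h => csInf_le (hbdd x) h
  have hlt : ∀ {x t}, N x < t → t • e - x ∈ C := by
    intro x t h
    obtain ⟨s, hs, hst⟩ := exists_lt_of_csInf_lt (hunit x) h
    exact hmono hst.le hs
  have hhom_le : ∀ c : ℝ, 0 < c → ∀ x, N (c • x) ≤ c * N x := by
    intro c hc x
    refine le_of_forall_pos_le_add fun δ hδ => ?_
    have h1 := hsmul c hc.le _ (hlt (lt_add_of_pos_right (N x) (div_pos hδ hc)))
    have h2 : N (c • x) ≤ c * (N x + δ / c) := hle (by rwa [smul_sub, smul_smul] at h1)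
    rwa [mul_add, mul_div_cancel₀ _ hc.ne'] at h2
  have hhom : ∀ c : ℝ, 0 < c → ∀ x, N (c • x) = c * N x := by
    intro c hc x
    refine le_antisymm (hhom_le c hc x) ?_
    have := hhom_le c⁻¹ (inv_pos.2 hc) (c • x)
    rw [smul_smul, inv_mul_cancel₀ hc.ne', one_smul] at this
    rwa [inv_mul_eq_div, le_div_iff₀ hc, mul_comm] at this
  have hsub : ∀ x y, N (x + y) ≤ N x + N y := by
    intro x y
    refine le_of_forall_pos_le_add fun δ hδ => ?_
    have h1 := hadd _ (hlt (lt_add_of_pos_right (N x) (half_pos hδ))) _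
      (hlt (lt_add_of_pos_right (N y) (half_pos hδ)))
    have h2 : N (x + y) ≤ (N x + δ / 2) + (N y + δ / 2) := hle (by convert h1 using 1; module)
    linarith
  have hN0 : N 0 = 0 := by
    have := hhom 2 two_pos 0
    rw [smul_zero] at this
    linarith
  have hx₀' : -x₀ ≠ 0 := by
    intro h
    rw [neg_eq_zero] at h
    exact hx₀ (by simpa [h] using hsmul ε hε.le e he)
  have hNx₀ : ε ≤ N (-x₀) := by
    by_contra! h
    exact hx₀ (by simpa using hlt h)
  -- Hahn–Banach from the line through `-x₀`, where `N` takes a value at least `ε`.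
  obtain ⟨g, hg, hgN⟩ := exists_extension_of_le_sublinear
    (LinearPMap.mkSpanSingleton (K := ℝ) (-x₀) (N (-x₀)) hx₀') N hhom hsub (by
      rintro ⟨x, hx⟩
      obtain ⟨c, rfl⟩ := Submodule.mem_span_singleton.1 hx
      have hc' : LinearPMap.mkSpanSingleton (K := ℝ) (-x₀) (N (-x₀)) hx₀' ⟨c • -x₀, hx⟩ =
          c * N (-x₀) := LinearPMap.mkSpanSingleton'_apply ..
      rw [hc']
      change _ ≤ N (c • -x₀)
      rcases lt_trichotomy c 0 with hc | rfl | hc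
      · have h1 := hsub (c • -x₀) ((-c) • -x₀)
        rw [hhom (-c) (by linarith), ← add_smul, add_neg_cancel, zero_smul, hN0] at h1
        linarith
      · simp [hN0]
      · exact (hhom c hc _).ge)
  have hgx₀ : g (-x₀) = N (-x₀) := by
    have := hg ⟨-x₀, Submodule.mem_span_singleton_self _⟩
    rw [this]
    exact LinearPMap.mkSpanSingleton'_apply_self ..
  -- Positivity and normalisation both come from `g ≤ N`, as `N (-x) ≤ 0` for `x ∈ C`, `N e ≤ 1` and
  -- `N (-e) ≤ -1`.
  refine ⟨g, fun x hx => ?_, le_antisymm ?_ ?_, ?_⟩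
  · have h1 := (hgN (-x)).trans (hle (t := 0) (by simpa using hx))
    rw [map_neg] at h1
    linarith
  · exact (hgN e).trans (hle (by simpa using hzero))
  · have h1 := (hgN (-e)).trans (hle (t := -1) (by simpa using hzero))
    rw [map_neg] at h1
    linarith
  · rw [map_neg] at hgx₀
    linarith

/-! ### The matrix pairing and contractivity of matrix states -/

section Pairing

variable {A : Type*} [AddCommGroup A] [Module ℂ A] {r n : ℕ+}

theorem pairing_apply (φ : A →ₗ[ℂ] Mat r ℂ) (a : Mat n A) (p q : Fin r × Fin n) :
    pairing φ a p q = φ (a p.2 q.2) p.1 q.1 := rfl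

theorem pairing_add (φ : A →ₗ[ℂ] Mat r ℂ) (a b : Mat n A) :
    pairing φ (a + b) = pairing φ a + pairing φ b := by
  ext; simp [pairing]

theorem pairing_smul (φ : A →ₗ[ℂ] Mat r ℂ) (c : ℂ) (a : Mat n A) :
    pairing φ (c • a) = c • pairing φ a := by
  ext; simp [pairing]

end Pairing

theorem l2_opNorm_le_bound {σ τ : Type*} [Fintype σ] [Fintype τ] [DecidableEq τ]
    {B : Matrix σ τ ℂ} {c : ℝ} (hc : 0 ≤ c)
    (h : ∀ x : τ → ℂ, ‖WithLp.toLp 2 (B *ᵥ x)‖ ≤ c * ‖WithLp.toLp 2 x‖) : ‖B‖ ≤ c := by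
  rw [Matrix.l2_opNorm_def]
  exact ContinuousLinearMap.opNorm_le_bound _ hc fun x => h x.ofLp

/-- The Schur complement gives `t - t⁻¹ Bᴴ B ≥ 0`, that is, `‖B x‖² ≤ t² ‖x‖²` for every vector `x`.
-/
theorem norm_le_of_posSemidef_fromBlocks {σ τ : Type*} [Fintype σ] [Fintype τ] [DecidableEq σ]
    [DecidableEq τ] {B : Matrix σ τ ℂ} {C : Matrix τ σ ℂ} {t : ℝ} (ht : 0 < t)
    (h : (Matrix.fromBlocks ((t : ℂ) • 1) B C ((t : ℂ) • 1)).PosSemidef) : ‖B‖ ≤ t := by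
  obtain ⟨-, -, hC, -⟩ := Matrix.isHermitian_fromBlocks_iff.1 h.1
  have hC : C = Bᴴ := by rw [← hC, Matrix.conjTranspose_conjTranspose]
  have hd : ((t : ℂ) • (1 : Matrix σ σ ℂ)).PosDef := Matrix.PosDef.one.smul (by exact_mod_cast ht)
  have := hd.isUnit.invertible
  rw [hC, Matrix.PosDef.fromBlocks₁₁ _ _ hd] at h
  have ht' : (t : ℂ) ≠ 0 := by exact_mod_cast ht.ne'
  have hinv : ((t : ℂ) • (1 : Matrix σ σ ℂ))⁻¹ = (t : ℂ)⁻¹ • 1 := by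
    refine Matrix.inv_eq_right_inv ?_
    rw [Matrix.smul_mul, Matrix.mul_smul, smul_smul, mul_inv_cancel₀ ht', one_mul, one_smul]
  refine l2_opNorm_le_bound ht.le fun x => ?_
  have h1 := h.dotProduct_mulVec_nonneg x
  have h2 : star x ⬝ᵥ ((t : ℂ) • (1 : Matrix τ τ ℂ) - Bᴴ * ((t : ℂ) • (1 : Matrix σ σ ℂ))⁻¹ * B) *ᵥ x
      = ((t * ‖WithLp.toLp 2 x‖ ^ 2 - t⁻¹ * ‖WithLp.toLp 2 (B *ᵥ x)‖ ^ 2 : ℝ) : ℂ) := by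
    rw [hinv, Matrix.mul_smul, Matrix.smul_mul, Matrix.mul_one, Matrix.sub_mulVec, Matrix.smul_mulVec,
      Matrix.smul_mulVec, dotProduct_sub, dotProduct_smul, dotProduct_smul, Matrix.one_mulVec,
      ← Matrix.mulVec_mulVec, Matrix.dotProduct_mulVec, ← Matrix.star_mulVec,
      MatrixOrderUnitSpace.star_dotProduct_self, MatrixOrderUnitSpace.star_dotProduct_self]
    push_cast
    simp
  rw [h2] at h1
  have h3 : 0 ≤ t * ‖WithLp.toLp 2 x‖ ^ 2 - t⁻¹ * ‖WithLp.toLp 2 (B *ᵥ x)‖ ^ 2 := by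
    exact_mod_cast h1
  refine le_of_sq_le_sq ?_ (by positivity)
  have h4 := mul_le_mul_of_nonneg_left (sub_nonneg.1 h3) ht.le
  rw [← mul_assoc, mul_inv_cancel₀ ht.ne', one_mul] at h4
  nlinarith

namespace MatrixOrderUnitSpace

variable {A : Type*} [AddCommGroup A] [Module ℂ A] [StarAddMonoid A] [StarModule ℂ A]
  {X : MatrixOrderUnitSpace A}

/-- Complete positivity carries the block matrix defining the norm to a positive scalar block
matrix, and unitality keeps `t` on its diagonal. -/
theorem IsMatrixState.norm_pairing_le {r n : ℕ+} {φ : A →ₗ[ℂ] Mat r ℂ} (hφ : X.IsMatrixState φ)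
    (a : Mat n A) : ‖pairing φ a‖ ≤ X.matNorm a := by
  refine le_of_forall_gt_imp_ge_of_dense fun t ht => ?_
  have h0 := (matNorm_nonneg (X := X) a).trans_lt ht
  have h1 := bound_of_matNorm_lt ht
  have h2 := hφ.completelyPositive _ _ ((posOn_reindex_iff (sumIdx n n)).2 h1)
  have h3 := h2.submatrix (fun p : (Fin r × Fin n) ⊕ (Fin r × Fin n) =>
    Sum.elim (fun p => (p.1, sumIdx n n (Sum.inl p.2))) (fun p => (p.1, sumIdx n n (Sum.inr p.2))) p)
  refine norm_le_of_posSemidef_fromBlocks h0 (C := pairing φ aᴴ) ?_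
  convert h3 using 1
  have e : ∀ i j : Fin n, ∀ k l : Fin r, φ (((t : ℂ) • X.unitMat (1 : Mat n ℂ)) i j) k l =
      ((t : ℂ) • (1 : Matrix (Fin r × Fin n) (Fin r × Fin n) ℂ)) (k, i) (l, j) := by
    intro i j k l
    by_cases hij : i = j
    · simp [unitMat, hij, hφ.unital, Matrix.one_apply]
    · simp [unitMat, hij]
  set M := Matrix.fromBlocks ((t : ℂ) • X.unitMat (1 : Mat n ℂ)) a aᴴ ((t : ℂ) • X.unitMat 1)
  have e' : ∀ i j (k l : Fin r),
      pairing φ (Matrix.reindex (sumIdx n n) (sumIdx n n) M) (k, sumIdx n n i) (l, sumIdx n n j) =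
        φ (M i j) k l := by
    intro i j k l
    rw [pairing_apply, Matrix.reindex_apply, Matrix.submatrix_apply]
    simp only [Equiv.symm_apply_apply]
  ext (i | i) (j | j)
  · exact (e i.2 j.2 i.1 j.1).symm.trans (e' (.inl i.2) (.inl j.2) i.1 j.1).symm
  · exact (e' (.inl i.2) (.inr j.2) i.1 j.1).symm
  · exact (e' (.inr i.2) (.inl j.2) i.1 j.1).symm
  · exact (e i.2 j.2 i.1 j.1).symm.trans (e' (.inr i.2) (.inr j.2) i.1 j.1).symm

theorem IsMatrixState.pairing_scalarMat {r n : ℕ+} {φ ψ : A →ₗ[ℂ] Mat r ℂ}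
    (hφ : X.IsMatrixState φ) (hψ : X.IsMatrixState ψ) (α : Mat n ℂ) :
    pairing φ (X.scalarMat α) = pairing ψ (X.scalarMat α) := by
  ext p q
  simp [pairing, scalarMat, hφ.unital, hψ.unital]

end MatrixOrderUnitSpace
end MatrixMetric

/-! ### Scalar-valued states -/

namespace MatrixMetric
namespace MatrixOrderUnitSpace

variable {A : Type*} [AddCommGroup A] [Module ℂ A] [StarAddMonoid A] [StarModule ℂ A]
  {X : MatrixOrderUnitSpace A}

variable (X) in
/-- The scalar-valued states of `A`, as a set of functions. -/
def stateSet : Set (A → ℂ) :=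
  {f | (∀ x y, f (x + y) = f x + f y) ∧ (∀ (c : ℂ) x, f (c • x) = c * f x) ∧ f X.one = 1 ∧
    ∀ x, single x ∈ X.cone 1 → 0 ≤ f x}

/-- The linear map `A → M_1` of a scalar-valued state. -/
def stateLin {f : A → ℂ} (hf : f ∈ X.stateSet) : A →ₗ[ℂ] Mat 1 ℂ where
  toFun x := single (f x)
  map_add' x y := by ext; exact hf.1 x y
  map_smul' c x := by ext; exact hf.2.1 c x

theorem stateLin_apply {f : A → ℂ} (hf : f ∈ X.stateSet) (x : A) (i j : Fin (1 : ℕ+)) :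
    stateLin hf x i j = f x := rfl

theorem star_eq_of_single_mem {x : A} (h : single x ∈ X.cone 1) : star x = x :=
  congrFun (congrFun (X.selfAdjoint_of_mem h) (0 : Fin 1)) (0 : Fin 1)

theorem star_one : star X.one = X.one :=
  star_eq_of_single_mem (single_mem_cone_iff.2 X.posOn_elt_one)

theorem conj_apply_of_selfAdjoint {f : A → ℂ} (hf : f ∈ X.stateSet) {h : A} (hh : star h = h) :
    star (f h) = f h := by
  obtain ⟨t, -, h1, -⟩ := X.exists_single_mem hh
  have h2 := hf.2.2.2 _ h1
  rw [hf.1, hf.2.1, hf.2.2.1, mul_one] at h2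
  have h3 : (f h).im = 0 := by simpa using (Complex.nonneg_iff.1 h2).2.symm
  exact Complex.conj_eq_iff_im.2 h3

theorem apply_star {f : A → ℂ} (hf : f ∈ X.stateSet) (x : A) : f (star x) = star (f x) := by
  have h1 := conj_apply_of_selfAdjoint hf (ℜ x).2
  have h2 := conj_apply_of_selfAdjoint hf (ℑ x).2
  have e1 : star x = (ℜ x : A) + (-Complex.I) • (ℑ x : A) := by
    conv_lhs => rw [← realPart_add_I_smul_imaginaryPart x]
    rw [star_add, star_smul, (ℜ x).2, (ℑ x).2]
    simp
  conv_rhs => rw [← realPart_add_I_smul_imaginaryPart x]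
  rw [e1, hf.1, hf.1, hf.2.1, hf.2.1, star_add, star_mul', h1, h2]
  simp

/-- The column with entries those of a vector indexed by `Fin 1 × Fin n`. -/
def colOf {n : ℕ+} (σ : Type*) (v : Fin (1 : ℕ+) × Fin n → ℂ) : Matrix (Fin n) σ ℂ :=
  Matrix.of fun k _ => v ((0 : Fin 1), k)

theorem sum_fin_pnat_one (F : Fin (1 : ℕ+) → ℂ) : ∑ i, F i = F (0 : Fin 1) :=
  Fin.sum_univ_one F

/-- Moves the vectors inside `f`, as the compression `v* a w`. With `v = w` it shows that a positive
functional is completely positive; with unit vectors it reduces `K n` to `K 1`. -/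
theorem dotProduct_pairing_stateLin {f : A → ℂ} (hf : f ∈ X.stateSet) {n : ℕ+} (a : Mat n A)
    (v w : Fin (1 : ℕ+) × Fin n → ℂ) {σ : Type*} (i j : σ) :
    star v ⬝ᵥ pairing (stateLin hf) a *ᵥ w = f (sand (colOf σ v)ᴴ a (colOf σ w) i j) := by
  have hsum : ∀ {τ : Type} (s : Finset τ) (g : τ → A), f (∑ i ∈ s, g i) = ∑ i ∈ s, f (g i) := by
    intro τ s g
    have h0 : f 0 = 0 := by simpa using hf.2.1 0 0
    exact map_sum (AddMonoidHom.mk ⟨f, h0⟩ hf.1) g s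
  rw [sand_apply, hsum, dotProduct]
  simp only [hsum, Matrix.mulVec, dotProduct, hf.2.1, Finset.mul_sum, pairing_apply,
    stateLin_apply, Fintype.sum_prod_type]
  rw [sum_fin_pnat_one]
  refine Finset.sum_congr rfl fun k _ => ?_
  rw [sum_fin_pnat_one]
  refine Finset.sum_congr rfl fun l _ => ?_
  simp only [colOf, Matrix.conjTranspose_apply, Matrix.of_apply, Pi.star_apply]
  ring

theorem isMatrixState_stateLin {f : A → ℂ} (hf : f ∈ X.stateSet) :
    X.IsMatrixState (stateLin hf) where
  unital := by
    ext i j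
    have : i = j := Subsingleton.elim (α := Fin 1) i j
    rw [stateLin_apply, hf.2.2.1, this, Matrix.one_apply_eq]
  completelyPositive n a ha := by
    refine Matrix.PosSemidef.of_dotProduct_mulVec_nonneg ?_ fun v => ?_
    · ext p q
      have := congrFun (congrFun (X.selfAdjoint_of_mem ha) p.2) q.2
      rw [Matrix.conjTranspose_apply] at this
      rw [Matrix.conjTranspose_apply, pairing_apply, pairing_apply, stateLin_apply, stateLin_apply,
        ← apply_star hf, this]
    · rw [dotProduct_pairing_stateLin hf a v v () ()]
      exact hf.2.2.2 _ (single_mem_cone_iff.2 ((posOn_iff_mem_cone.2 ha).sand (colOf Unit v)))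

/-- The matrix state of a scalar-valued state. -/
def stateOf {f : A → ℂ} (hf : f ∈ X.stateSet) : X.CS 1 := ⟨stateLin hf, isMatrixState_stateLin hf⟩

theorem norm_entry_le_l2_opNorm {σ τ : Type*} [Fintype σ] [Fintype τ] [DecidableEq τ]
    (M : Matrix σ τ ℂ) (p : σ) (q : τ) : ‖M p q‖ ≤ ‖M‖ := by
  have h1 := Matrix.l2_opNorm_mulVec M (EuclideanSpace.single q 1)
  rw [PiLp.norm_single, norm_one, mul_one] at h1
  refine le_trans ?_ ((PiLp.norm_apply_le _ p).trans h1)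
  simp

theorem norm_apply_le {f : A → ℂ} (hf : f ∈ X.stateSet) {n : ℕ+} (a : Mat n A) (i j : Fin n) :
    ‖f (a i j)‖ ≤ ‖pairing (stateLin hf) a‖ :=
  norm_entry_le_l2_opNorm (pairing (stateLin hf) a) ((0 : Fin 1), i) ((0 : Fin 1), j)

theorem norm_colOf_le_one {n : ℕ+} {v : Fin (1 : ℕ+) × Fin n → ℂ} (hv : ‖WithLp.toLp 2 v‖ = 1) :
    ‖colOf (Fin (1 : ℕ+)) v‖ ≤ 1 := by
  refine norm_le_one_of_conjTranspose_mul_self ?_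
  have h := star_dotProduct_self v
  rw [hv, dotProduct, Fintype.sum_prod_type, sum_fin_pnat_one] at h
  ext i j
  have : i = j := Subsingleton.elim (α := Fin 1) i j
  rw [this, Matrix.one_apply_eq, Matrix.mul_apply]
  rw [one_pow, Complex.ofReal_one] at h
  exact h

/-- The distance of scalar-valued states is already attained on `K_1`. -/
theorem norm_pairing_sub_le {K : GradedSet A} (hK : IsAbsolutelyMatrixConvex K) {f g : A → ℂ}
    (hf : f ∈ X.stateSet) (hg : g ∈ X.stateSet) {c : ℝ} (hc : 0 ≤ c)
    (h : ∀ x, single x ∈ K 1 → ‖f x - g x‖ ≤ c) {n : ℕ+} {a : Mat n A} (ha : a ∈ K n) :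
    ‖pairing (stateLin hf) a - pairing (stateLin hg) a‖ ≤ c := by
  -- Unit vectors are contractive columns, so `v* a w` lies in `K 1` by absolute matrix convexity.
  have key : ∀ v w : Fin (1 : ℕ+) × Fin n → ℂ, ‖WithLp.toLp 2 v‖ = 1 → ‖WithLp.toLp 2 w‖ = 1 →
      ‖star v ⬝ᵥ (pairing (stateLin hf) a - pairing (stateLin hg) a) *ᵥ w‖ ≤ c := by
    intro v w hv hw
    rw [Matrix.sub_mulVec, dotProduct_sub,
      dotProduct_pairing_stateLin hf a v w (0 : Fin (1 : ℕ+)) (0 : Fin (1 : ℕ+)),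
      dotProduct_pairing_stateLin hg a v w (0 : Fin (1 : ℕ+)) (0 : Fin (1 : ℕ+))]
    refine h _ ?_
    convert hK.sandwich_mem (by rw [Matrix.l2_opNorm_conjTranspose]; exact norm_colOf_le_one hv)
      (norm_colOf_le_one hw) ha using 1
    ext i j
    rw [Subsingleton.elim (α := Fin 1) i (0 : Fin 1), Subsingleton.elim (α := Fin 1) j (0 : Fin 1)]
    rfl
  set M := pairing (stateLin hf) a - pairing (stateLin hg) a
  refine l2_opNorm_le_bound hc fun x => ?_
  by_cases hx : x = 0
  · rw [hx, Matrix.mulVec_zero, WithLp.toLp_zero, norm_zero, mul_zero]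
  by_cases hy : M *ᵥ x = 0
  · rw [hy, WithLp.toLp_zero, norm_zero]
    positivity
  have hx' : 0 < ‖WithLp.toLp 2 x‖ := norm_pos_iff.2 fun h => hx (congrArg WithLp.ofLp h)
  have hy' : 0 < ‖WithLp.toLp 2 (M *ᵥ x)‖ := norm_pos_iff.2 fun h => hy (congrArg WithLp.ofLp h)
  have hn : ∀ z : Fin (1 : ℕ+) × Fin n → ℂ, 0 < ‖WithLp.toLp 2 z‖ →
      ‖WithLp.toLp 2 (((‖WithLp.toLp 2 z‖⁻¹ : ℝ) : ℂ) • z)‖ = 1 := by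
    intro z hz
    rw [WithLp.toLp_smul, norm_smul, Complex.norm_real, norm_inv, norm_norm, inv_mul_cancel₀ hz.ne']
  have h1 := key _ _ (hn _ hy') (hn _ hx')
  rw [star_smul, Matrix.mulVec_smul, dotProduct_smul, smul_dotProduct, star_dotProduct_self,
    norm_smul, norm_smul, Complex.norm_real, norm_star, Complex.norm_real, Complex.norm_real,
    norm_inv, norm_inv, norm_norm, norm_norm, norm_pow, norm_norm] at h1
  rw [sq, inv_mul_cancel_left₀ hy'.ne', inv_mul_le_iff₀ hx'] at h1
  linarith

theorem norm_apply_le_matNorm {f : A → ℂ} (hf : f ∈ X.stateSet) (x : A) :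
    ‖f x‖ ≤ X.matNorm (single x) :=
  (norm_apply_le hf (single x) (0 : Fin 1) (0 : Fin 1)).trans
    ((isMatrixState_stateLin hf).norm_pairing_le _)

/-- A skew-adjoint element and its negative both have real part `0`, so `g` vanishes there. The
complexification `g x - i g (i x)` is then real on self-adjoint elements and equals `g` on them. -/
theorem exists_mem_stateSet {g : A →ₗ[ℝ] ℝ} (hg : ∀ x, single (ℜ x : A) ∈ X.cone 1 → 0 ≤ g x)
    (h1 : g X.one = 1) :
    ∃ f ∈ X.stateSet, ∀ x, f x = (g x : ℂ) - Complex.I * (g (Complex.I • x) : ℂ) := by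
  have him : ∀ x : A, star x = x → g (Complex.I • x) = 0 := by
    intro x hx
    have hre : ∀ c : ℝ, 0 ≤ g (c • Complex.I • x) := fun c => hg _ (by
      have : (ℜ (c • Complex.I • x) : A) = 0 := by
        rw [map_smul, realPart_I_smul, imaginaryPart_eq_zero_iff.2 hx]; simp
      rw [this]
      exact X.zero_mem 1)
    have h2 := hre 1
    have h3 := hre (-1)
    rw [map_smul, smul_eq_mul] at h2 h3
    linarith
  have hap : ∀ x, (Module.Dual.extendRCLike g : A →ₗ[ℂ] ℂ) x =
      (g x : ℂ) - Complex.I * (g (Complex.I • x) : ℂ) := fun x => Module.Dual.extendRCLike_apply g x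
  refine ⟨fun x => (Module.Dual.extendRCLike g : A →ₗ[ℂ] ℂ) x,
    ⟨map_add _, fun c x => map_smul _ c x, ?_, fun x hx => ?_⟩, hap⟩
  · simp only [hap, h1, him _ star_one]
    simp
  · have hs := star_eq_of_single_mem hx
    simp only [hap, him x hs]
    have : 0 ≤ g x := hg x (by
      rw [IsSelfAdjoint.coe_realPart hs]; exact hx)
    simpa using this

end MatrixOrderUnitSpace
end MatrixMetric

/-! ### States determine the norm, and separating subspaces are dense -/

namespace MatrixMetric

namespace MatrixOrderUnitSpace

variable {A : Type*} [AddCommGroup A] [Module ℂ A] [StarAddMonoid A] [StarModule ℂ A]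
  {X : MatrixOrderUnitSpace A}

theorem posOn_elt_add {x y : A} (hx : X.PosOn (elt x)) (hy : X.PosOn (elt y)) :
    X.PosOn (elt (x + y)) := hx.add hy

theorem posOn_elt_smul {x : A} (hx : X.PosOn (elt x)) {t : ℝ} (ht : 0 ≤ t) :
    X.PosOn (elt (t • x)) := by
  have := hx.smul ht
  rwa [Complex.coe_smul] at this

theorem realPart_smul_one_add (t : ℝ) (x : A) :
    (ℜ (t • X.one + x) : A) = t • X.one + (ℜ x : A) := by
  rw [map_add, map_smul, AddSubgroup.coe_add, selfAdjoint.val_smul,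
    IsSelfAdjoint.coe_realPart (star_one (X := X))]

theorem realPart_smul_one_sub (t : ℝ) (x : A) :
    (ℜ (t • X.one - x) : A) = t • X.one - (ℜ x : A) := by
  rw [sub_eq_add_neg, realPart_smul_one_add, map_neg, AddSubgroup.coe_neg, sub_eq_add_neg]

theorem exists_posOn_smul_one_sub (X : MatrixOrderUnitSpace A) (x : A) :
    ∃ t : ℝ, X.PosOn (elt (ℜ (t • X.one - x) : A)) := by
  obtain ⟨t, -, -, h⟩ := X.exists_single_mem (h := (ℜ x : A)) (ℜ x).2
  refine ⟨t, ?_⟩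
  rw [realPart_smul_one_sub]
  simpa [Complex.coe_smul] using single_mem_cone_iff.1 h

/-- Otherwise `c 1 - h` stays outside the cone after adding `(d - c) 1`, and a state negative at `c
1 - h` exceeds `c` at `h`. Taking the cone of elements with positive real part lets the separation
run in all of `A`. -/
theorem posOn_of_forall_state_le {h : A} (hh : star h = h) {c d : ℝ} (hcd : c < d)
    (hf : ∀ f ∈ X.stateSet, (f h).re ≤ c) : X.PosOn (elt (d • X.one - h)) := by
  by_contra hd
  have hre : (ℜ h : A) = h := IsSelfAdjoint.coe_realPart hh
  obtain ⟨g, hg, hg1, hgx⟩ := exists_state_neg (C := {x : A | X.PosOn (elt (ℜ x : A))})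
    (e := X.one) (x₀ := c • X.one - h) (ε := d - c)
    (fun x hx y hy => by
      rw [Set.mem_ofPred_eq, map_add, AddSubgroup.coe_add]; exact posOn_elt_add hx hy)
    (fun t ht x hx => by
      rw [Set.mem_ofPred_eq, map_smul, selfAdjoint.val_smul]; exact posOn_elt_smul hx ht)
    (by
      rw [Set.mem_ofPred_eq, IsSelfAdjoint.coe_realPart (star_one (X := X))]; exact X.posOn_elt_one)
    X.exists_posOn_smul_one_sub (sub_pos.2 hcd) (by
      rwa [← add_sub_assoc, ← add_smul, sub_add_cancel, Set.mem_ofPred_eq, realPart_smul_one_sub, hre])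
  obtain ⟨f, hfs, hfg⟩ := exists_mem_stateSet (X := X) (fun x hx => hg x (single_mem_cone_iff.1 hx)) hg1
  have h1 := hf f hfs
  have h2 : (f h).re = g h := by simp [hfg]
  rw [map_sub, map_smul, hg1, smul_eq_mul, mul_one] at hgx
  linarith

theorem bound_of_forall_state_le {h : A} (hh : star h = h) {c d : ℝ} (hcd : c < d)
    (hf : ∀ f ∈ X.stateSet, |(f h).re| ≤ c) : X.Bound d (elt h) := by
  refine bound_elt_of_selfAdjoint hh (single_mem_cone_iff.2 ?_) (single_mem_cone_iff.2 ?_)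
  · have := posOn_of_forall_state_le (X := X) (h := -h) (by rw [star_neg, hh]) hcd fun f hfs => by
      have h1 : f (-h) = - f h := by simpa using hfs.2.1 (-1) h
      rw [h1, Complex.neg_re]
      exact (neg_le_abs _).trans (hf f hfs)
    simpa [Complex.coe_smul] using this
  · simpa [Complex.coe_smul] using
      posOn_of_forall_state_le hh hcd fun f hfs => (le_abs_self _).trans (hf f hfs)

/-- The scalar-valued states determine the norm of `M_n(A)` up to a constant. -/
theorem matNorm_le_of_forall_state {n : ℕ+} {a : Mat n A} {c d : ℝ} (hc : 0 ≤ c) (hcd : c < d)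
    (hf : ∀ f ∈ X.stateSet, ∀ i j, ‖f (a i j)‖ ≤ c) : X.matNorm a ≤ n * (n * (d + d)) := by
  have hd : 0 ≤ d := hc.trans hcd.le
  -- One `d` is for the real part of an entry and one for its imaginary part.
  have h := bound_of_entries (X := X) (a := a) (add_nonneg hd hd) fun i j => by
    have hparts : ∀ f ∈ X.stateSet, f (ℜ (a i j)) = (f (a i j)).re ∧
        f (ℑ (a i j)) = (f (a i j)).im := by
      intro f hfs
      have h1 := Complex.conj_eq_iff_real.1 (conj_apply_of_selfAdjoint hfs (ℜ (a i j)).2)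
      have h2 := Complex.conj_eq_iff_real.1 (conj_apply_of_selfAdjoint hfs (ℑ (a i j)).2)
      obtain ⟨s, hs⟩ := h1
      obtain ⟨t, ht⟩ := h2
      have h3 : f (a i j) = s + Complex.I * t := by
        conv_lhs => rw [← realPart_add_I_smul_imaginaryPart (a i j)]
        rw [hfs.1, hfs.2.1, hs, ht]
      rw [hs, ht, h3]
      simp
    refine bound_elt_of_realPart hd
      (bound_of_forall_state_le (ℜ (a i j)).2 hcd fun f hfs => ?_)
      (bound_of_forall_state_le (ℑ (a i j)).2 hcd fun f hfs => ?_)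
    · rw [(hparts f hfs).1, Complex.ofReal_re]
      exact (Complex.abs_re_le_norm _).trans (hf f hfs i j)
    · rw [(hparts f hfs).2, Complex.ofReal_re]
      exact (Complex.abs_im_le_norm _).trans (hf f hfs i j)
  refine matNorm_le (by positivity) ?_
  simpa using h

/-- A self-adjoint subspace that contains `1` and separates the states is dense. -/
theorem exists_bound_sub_of_selfAdjoint {V : Submodule ℂ A} (hstar : ∀ v ∈ V, star v ∈ V)
    (hone : X.one ∈ V)
    (hsep : ∀ f ∈ X.stateSet, ∀ g ∈ X.stateSet, (∀ v ∈ V, f v = g v) → f = g)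
    {a : A} (ha : star a = a) {ε : ℝ} (hε : 0 < ε) : ∃ v ∈ V, X.Bound ε (elt (a - v)) := by
  by_contra! hno
  have hre : (ℜ a : A) = a := IsSelfAdjoint.coe_realPart ha
  have hone' : (ℜ X.one : A) = X.one := IsSelfAdjoint.coe_realPart (star_one (X := X))
  have hVre : ∀ v ∈ V, (ℜ v : A) ∈ V := fun v hv => by
    rw [realPart_apply_coe, ← Complex.coe_smul]
    exact V.smul_mem _ (V.add_mem hv (hstar v hv))
  have hzero : ∀ x : A, x = 0 → X.PosOn (elt (ℜ x : A)) := by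
    rintro x rfl
    rw [map_zero]
    exact posOn_zero
  -- In `A × A`, take the pairs that become positive after adding `v` to one component and
  -- subtracting the same `v ∈ V` from the other. Then `ε (1, 1) + (a, -a)` in this cone would put
  -- `a` within `ε` of `V`, while a positive functional on it is a pair of positive functionals
  -- agreeing on `V`.
  obtain ⟨g, hg, hg1, hgx⟩ := exists_state_neg
    (C := {p : A × A | ∃ v ∈ V, X.PosOn (elt (ℜ (p.1 + v) : A)) ∧ X.PosOn (elt (ℜ (p.2 - v) : A))})
    (e := (X.one, X.one)) (x₀ := (a, -a)) (ε := ε)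
    (by
      rintro x ⟨v, hv, h1, h2⟩ y ⟨w, hw, h3, h4⟩
      refine ⟨v + w, V.add_mem hv hw, ?_, ?_⟩
      · rw [Prod.fst_add, add_add_add_comm, map_add, AddSubgroup.coe_add]
        exact posOn_elt_add h1 h3
      · rw [Prod.snd_add, add_sub_add_comm, map_add, AddSubgroup.coe_add]
        exact posOn_elt_add h2 h4)
    (by
      rintro t ht x ⟨v, hv, h1, h2⟩
      refine ⟨t • v, by rw [← Complex.coe_smul]; exact V.smul_mem _ hv, ?_, ?_⟩
      · rw [Prod.smul_fst, ← smul_add, map_smul, selfAdjoint.val_smul]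
        exact posOn_elt_smul h1 ht
      · rw [Prod.smul_snd, ← smul_sub, map_smul, selfAdjoint.val_smul]
        exact posOn_elt_smul h2 ht)
    ⟨0, V.zero_mem, by rw [add_zero, hone']; exact X.posOn_elt_one,
      by rw [sub_zero, hone']; exact X.posOn_elt_one⟩
    (by
      intro x
      obtain ⟨s, hs⟩ := X.exists_posOn_smul_one_sub x.1
      obtain ⟨t, ht⟩ := X.exists_posOn_smul_one_sub x.2
      have hmono : ∀ (r r' : ℝ) (y : A), r ≤ r' → X.PosOn (elt (ℜ (r • X.one - y) : A)) →
          X.PosOn (elt (ℜ (r' • X.one - y) : A)) := by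
        intro r r' y hr h
        rw [realPart_smul_one_sub] at h ⊢
        convert posOn_elt_add h (posOn_elt_smul X.posOn_elt_one (sub_nonneg.2 hr)) using 2
        module
      refine ⟨max s t, 0, V.zero_mem, ?_, ?_⟩
      · rw [add_zero]
        exact hmono _ _ _ (le_max_left s t) hs
      · rw [sub_zero]
        exact hmono _ _ _ (le_max_right s t) ht)
    hε
    (by
      rintro ⟨v, hv, h1, h2⟩
      refine hno (-(ℜ v : A)) (V.neg_mem (hVre v hv)) ?_
      refine bound_elt_of_selfAdjoint ?_ (single_mem_cone_iff.2 ?_) (single_mem_cone_iff.2 ?_)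
      · rw [sub_neg_eq_add, star_add, ha, (ℜ v).2]
      · convert h1 using 2
        simp only [Prod.fst_add, Prod.smul_fst, add_assoc]
        rw [realPart_smul_one_add, map_add, AddSubgroup.coe_add, hre, Complex.coe_smul,
          sub_neg_eq_add]
      · convert h2 using 2
        simp only [Prod.snd_add, Prod.smul_snd, add_sub_assoc]
        rw [realPart_smul_one_add, map_sub, AddSubgroup.coe_sub, map_neg, AddSubgroup.coe_neg, hre,
          Complex.coe_smul]
        abel)
  have hgV : ∀ v ∈ V, g (v, 0) = g (0, v) := by
    have h1 : ∀ v ∈ V, 0 ≤ g (v, -v) := fun v hv =>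
      hg _ ⟨-v, V.neg_mem hv, hzero _ (add_neg_cancel v), hzero _ (by simp)⟩
    have h2 : ∀ v, g (v, -v) = g (v, 0) - g (0, v) := fun v => by
      rw [← map_sub]; simp
    intro v hv
    have h3 := h1 v hv
    have h4 := h1 (-v) (V.neg_mem hv)
    rw [show (-v, - -v) = -(v, -v) from rfl, map_neg] at h4
    linarith [h2 v]
  have hsum : g (X.one, 0) + g (0, X.one) = 1 := by
    rw [← map_add, ← hg1]; simp
  -- As `1 ∈ V`, both components of `g` take the value `1/2` at `1`; doubling each gives a state.
  have hhalf := hgV _ hone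
  obtain ⟨f₁, hf₁, hfg₁⟩ := exists_mem_stateSet (X := X) (g := (2 : ℝ) • g.comp (LinearMap.inl ℝ A A))
    (fun x hx => by
      have := hg (x, 0) ⟨0, V.zero_mem, by rw [add_zero]; exact single_mem_cone_iff.1 hx,
        hzero _ (by simp)⟩
      simpa using this)
    (by
      simp only [LinearMap.smul_apply, LinearMap.comp_apply, LinearMap.inl_apply, smul_eq_mul]
      linarith)
  obtain ⟨f₂, hf₂, hfg₂⟩ := exists_mem_stateSet (X := X) (g := (2 : ℝ) • g.comp (LinearMap.inr ℝ A A))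
    (fun x hx => by
      have := hg (0, x) ⟨0, V.zero_mem, hzero _ (by simp),
        by rw [sub_zero]; exact single_mem_cone_iff.1 hx⟩
      simpa using this)
    (by
      simp only [LinearMap.smul_apply, LinearMap.comp_apply, LinearMap.inr_apply, smul_eq_mul]
      linarith)
  have heq := hsep f₁ hf₁ f₂ hf₂ fun v hv => by
    rw [hfg₁, hfg₂]
    simp [hgV v hv, hgV _ (V.smul_mem Complex.I hv)]
  -- Equality of the two states gives `g (a, -a) = 0`, against the strict negativity from
  -- separation.
  have h1 : (f₁ a).re = (f₂ a).re := by rw [heq]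
  have h2 : (f₁ a).re = 2 * g (a, 0) := by simp [hfg₁]
  have h3 : (f₂ a).re = 2 * g (0, a) := by simp [hfg₂]
  have h4 : g (a, -a) = g (a, 0) - g (0, a) := by rw [← map_sub]; simp
  linarith

theorem exists_bound_sub {V : Submodule ℂ A} (hstar : ∀ v ∈ V, star v ∈ V) (hone : X.one ∈ V)
    (hsep : ∀ f ∈ X.stateSet, ∀ g ∈ X.stateSet, (∀ v ∈ V, f v = g v) → f = g)
    (a : A) {ε : ℝ} (hε : 0 < ε) : ∃ v ∈ V, X.Bound ε (elt (a - v)) := by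
  obtain ⟨v, hv, h1⟩ := exists_bound_sub_of_selfAdjoint hstar hone hsep (ℜ a).2 (half_pos hε)
  obtain ⟨w, hw, h2⟩ := exists_bound_sub_of_selfAdjoint hstar hone hsep (ℑ a).2 (half_pos hε)
  refine ⟨v + Complex.I • w, V.add_mem hv (V.smul_mem _ hw), ?_⟩
  convert h1.add (Bound.smul_le (half_pos hε).le h2 (c := Complex.I) (by simp)) using 1
  · ring
  · ext
    conv_lhs => rw [← realPart_add_I_smul_imaginaryPart a]
    simp only [elt_apply, Matrix.add_apply, Matrix.smul_apply, smul_sub]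
    abel

end MatrixOrderUnitSpace
end MatrixMetric

/-! ### Absolutely matrix convex sets and density of the span of `K` and the scalars -/

namespace MatrixMetric

section Convex

variable {V : Type*} [AddCommGroup V] [Module ℂ V] {K : GradedSet V}

theorem IsAbsolutelyMatrixConvex.zero_mem (hK : IsAbsolutelyMatrixConvex K)
    (hne : ∃ n : ℕ+, (K n).Nonempty) (n : ℕ+) : (0 : Mat n V) ∈ K n := by
  obtain ⟨m, v, hv⟩ := hne
  convert hK.sandwich_mem (α := (0 : Matrix (Fin n) (Fin m) ℂ)) (β := 0) (by simp) (by simp) hv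
  ext
  simp [sandwich_eq_sand, sand_apply]

theorem IsAbsolutelyMatrixConvex.smul_mem (hK : IsAbsolutelyMatrixConvex K) {n : ℕ+} {v : Mat n V}
    (hv : v ∈ K n) {c : ℂ} (hc : ‖c‖ ≤ 1) : c • v ∈ K n := by
  have := hK.sandwich_mem (α := c • 1) (β := 1) (MatrixOrderUnitSpace.norm_smul_one_le hc)
    (by simp) hv
  rwa [sandwich_eq_sand, sand_smul_left, sand_one] at this

/-- The midpoint is the compression of `v ⊕ w` by the isometry with two blocks `1/√2`. -/
theorem IsAbsolutelyMatrixConvex.half_smul_add_mem (hK : IsAbsolutelyMatrixConvex K) {n : ℕ+}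
    {v w : Mat n V} (hv : v ∈ K n) (hw : w ∈ K n) : (2⁻¹ : ℂ) • (v + w) ∈ K n := by
  set s : ℂ := Complex.ofReal (Real.sqrt 2)⁻¹ with hs
  have hss : s * s = 2⁻¹ := by
    rw [hs, ← Complex.ofReal_mul, ← mul_inv, Real.mul_self_sqrt zero_le_two]
    simp
  have hstar : star s = s := Complex.conj_ofReal _
  let β : Matrix (Fin ((n + n : ℕ+) : ℕ)) (Fin n) ℂ :=
    (Matrix.fromRows (s • (1 : Matrix (Fin n) (Fin n) ℂ)) (s • 1)).submatrix (sumIdx n n).symm id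
  have hβ : ‖β‖ ≤ 1 := by
    refine MatrixOrderUnitSpace.norm_le_one_of_conjTranspose_mul_self ?_
    rw [Matrix.conjTranspose_submatrix, Matrix.submatrix_mul_equiv,
      Matrix.conjTranspose_fromRows_eq_fromCols_conjTranspose, Matrix.fromCols_mul_fromRows]
    simp only [Matrix.conjTranspose_smul, Matrix.conjTranspose_one, hstar,
      Matrix.mul_smul, Matrix.mul_one, smul_smul, hss, Matrix.submatrix_id_id]
    module
  have h := hK.sandwich_mem (α := βᴴ) (β := β) (by rwa [Matrix.l2_opNorm_conjTranspose]) hβ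
    (hK.directSum_mem hv hw)
  rw [sandwich_eq_sand, Matrix.conjTranspose_submatrix, directSum, blocks, Matrix.reindex_apply,
    sand_submatrix_equiv, Matrix.conjTranspose_fromRows_eq_fromCols_conjTranspose,
    sand_fromCols_fromRows] at h
  simpa only [Matrix.conjTranspose_smul, Matrix.conjTranspose_one, hstar, sand_smul_left,
    sand_smul_right, sand_one, smul_smul, hss, ← smul_add] using h

theorem IsAbsolutelyMatrixConvex.exists_smul_of_le (hK : IsAbsolutelyMatrixConvex K) {n : ℕ+}
    {v : Mat n V} (hv : v ∈ K n) {s t : ℝ} (hs : 0 < s) (hst : s ≤ t) :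
    ∃ w ∈ K n, (s : ℂ) • v = (t : ℂ) • w := by
  have ht := hs.trans_le hst
  have ht' : (t : ℂ) ≠ 0 := by exact_mod_cast ht.ne'
  refine ⟨((s / t : ℝ) : ℂ) • v, hK.smul_mem hv ?_, ?_⟩
  · rw [Complex.norm_real, Real.norm_of_nonneg (by positivity)]
    exact div_le_one_of_le₀ hst ht.le
  · rw [smul_smul]
    push_cast
    rw [mul_div_cancel₀ _ ht']

/-- The subspace of `M_n(V)` spanned by `K_n`. -/
def multiples (K : GradedSet V) (hK : IsAbsolutelyMatrixConvex K)
    (hne : ∃ n : ℕ+, (K n).Nonempty) (n : ℕ+) : Submodule ℂ (Mat n V) where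
  carrier := {a | ∃ t : ℝ, 0 < t ∧ ∃ v ∈ K n, a = (t : ℂ) • v}
  zero_mem' := ⟨1, one_pos, 0, hK.zero_mem hne n, by simp⟩
  add_mem' := by
    rintro _ _ ⟨s, hs, v, hv, rfl⟩ ⟨t, ht, w, hw, rfl⟩
    obtain ⟨v', hv', h1⟩ := hK.exists_smul_of_le hv hs (le_max_left s t)
    obtain ⟨w', hw', h2⟩ := hK.exists_smul_of_le hw ht (le_max_right s t)
    refine ⟨2 * max s t, by positivity, _, hK.half_smul_add_mem hv' hw', ?_⟩
    rw [h1, h2, ← smul_add, smul_smul]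
    congr 1
    push_cast
    ring
  smul_mem' := by
    rintro c _ ⟨t, ht, v, hv, rfl⟩
    -- Scaling by `‖c‖ + 1` instead of `‖c‖` keeps the multiple positive when `c = 0`.
    have hc : 0 < ‖c‖ + 1 := by positivity
    have hc' : ((‖c‖ + 1 : ℝ) : ℂ) ≠ 0 := by exact_mod_cast hc.ne'
    refine ⟨(‖c‖ + 1) * t, by positivity, (c / (‖c‖ + 1 : ℝ)) • v, hK.smul_mem hv ?_, ?_⟩
    · rw [norm_div, Complex.norm_real, Real.norm_of_nonneg hc.le]
      exact div_le_one_of_le₀ (by linarith) hc.le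
    · rw [smul_smul, smul_smul]
      congr 1
      rw [Complex.ofReal_mul]
      field_simp

end Convex

instance : Unique (Fin ((1 : ℕ+) : ℕ)) := inferInstanceAs (Unique (Fin 1))

namespace MatrixOrderUnitSpace

variable {A : Type*} [AddCommGroup A] [Module ℂ A] [StarAddMonoid A] [StarModule ℂ A]
  {X : MatrixOrderUnitSpace A} {K : GradedSet A}

/-- The linear map `α ↦ [α_{ij} 1]`. -/
def scalarLin (X : MatrixOrderUnitSpace A) (n : ℕ+) : Mat n ℂ →ₗ[ℂ] Mat n A where
  toFun := X.scalarMat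
  map_add' := unitMat_add
  map_smul' := unitMat_smul

/-- The subspace of `M_n(A)` spanned by `K_n` and `M_n(ℂ1)`. -/
def lipschitz (hK : X.IsMatrixMetricSet K) (n : ℕ+) : Submodule ℂ (Mat n A) :=
  multiples K hK.absolutelyMatrixConvex hK.nonempty n ⊔ (X.scalarLin n).range

theorem mem_lipschitz (hK : X.IsMatrixMetricSet K) {n : ℕ+} {a : Mat n A} :
    a ∈ lipschitz hK n ↔
      ∃ t : ℝ, 0 < t ∧ ∃ v ∈ K n, ∃ α : Mat n ℂ, a = (t : ℂ) • v + X.scalarMat α := by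
  rw [lipschitz, Submodule.mem_sup]
  constructor
  · rintro ⟨_, ⟨t, ht, v, hv, rfl⟩, _, ⟨α, rfl⟩, rfl⟩
    exact ⟨t, ht, v, hv, α, rfl⟩
  · rintro ⟨t, ht, v, hv, α, rfl⟩
    exact ⟨_, ⟨t, ht, v, hv, rfl⟩, _, ⟨α, rfl⟩, rfl⟩

theorem sandwich_mem_lipschitz {hK : X.IsMatrixMetricSet K} {m n : ℕ+}
    {α : Matrix (Fin n) (Fin m) ℂ} {β : Matrix (Fin m) (Fin n) ℂ} (hα : ‖α‖ ≤ 1) (hβ : ‖β‖ ≤ 1)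
    {a : Mat m A} (ha : a ∈ lipschitz hK m) : sandwich α a β ∈ lipschitz hK n := by
  obtain ⟨t, ht, v, hv, μ, rfl⟩ := (mem_lipschitz hK).1 ha
  refine (mem_lipschitz hK).2 ⟨t, ht, _, hK.absolutelyMatrixConvex.sandwich_mem hα hβ hv, α * μ * β, ?_⟩
  rw [sandwich_eq_sand, sandwich_eq_sand, sand_add, sand_smul]
  congr 1
  exact sand_unitMat α μ β

theorem conjTranspose_mem_lipschitz (hK : X.IsMatrixMetricSet K) {n : ℕ+} {a : Mat n A}
    (ha : a ∈ lipschitz hK n) : aᴴ ∈ lipschitz hK n := by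
  obtain ⟨t, ht, v, hv, μ, rfl⟩ := (mem_lipschitz hK).1 ha
  refine (mem_lipschitz hK).2 ⟨t, ht, _, hK.selfAdjoint hv, μᴴ, ?_⟩
  rw [Matrix.conjTranspose_add, Matrix.conjTranspose_smul]
  congr 1
  · simp
  · ext
    simp [scalarMat, star_one]

theorem single_apply_eq_sandwich {n : ℕ+} (a : Mat n A) (i j : Fin n) :
    single (a i j) = sandwich
      (Matrix.of fun (_ : Fin (1 : ℕ+)) k => if k = i then (1 : ℂ) else 0) a
      (Matrix.of fun k (_ : Fin (1 : ℕ+)) => if k = j then (1 : ℂ) else 0) := by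
  ext k l
  rw [sandwich_eq_sand]
  simp only [sand_apply, Matrix.of_apply, mul_ite, mul_one, mul_zero, ite_smul, one_smul,
    zero_smul, Finset.sum_ite_eq', Finset.mem_univ, if_true, single]

theorem eq_sum_sandwich {n : ℕ+} (a : Mat n A) :
    a = ∑ i, ∑ j, sandwich (Matrix.of fun k (_ : Fin (1 : ℕ+)) => if k = i then (1 : ℂ) else 0)
      (single (a i j)) (Matrix.of fun (_ : Fin (1 : ℕ+)) k => if k = j then (1 : ℂ) else 0) := by
  ext k l
  have hone : ∀ (F : Fin (1 : ℕ+) → A), ∑ i, F i = F (0 : Fin 1) := Fin.sum_univ_one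
  simp only [Matrix.sum_apply, sandwich_eq_sand, sand_apply, hone, single, Matrix.of_apply,
    ite_mul, one_mul, zero_mul, ite_smul, one_smul, zero_smul]
  simp

/-- The elements of `A` in the span of `K_1` and `1`. -/
def lipschitzOne (hK : X.IsMatrixMetricSet K) : Submodule ℂ A where
  carrier := {x | single x ∈ lipschitz hK 1}
  zero_mem' := (lipschitz hK 1).zero_mem
  add_mem' := fun hx hy => (lipschitz hK 1).add_mem hx hy
  smul_mem' := fun c _ hx => (lipschitz hK 1).smul_mem c hx

/-- Entries of elements of `K n` are compressions lying in `K 1`, so states that agree on the span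
of `K 1` and `1` have equal pairings with every `K n`. -/
theorem eq_of_eqOn_lipschitzOne (hK : X.IsMatrixMetricSet K) {f g : A → ℂ} (hf : f ∈ X.stateSet)
    (hg : g ∈ X.stateSet) (h : ∀ v ∈ lipschitzOne hK, f v = g v) : f = g := by
  by_contra hne
  have hne' : stateOf hf ≠ stateOf hg := by
    intro heq
    refine hne (funext fun x => ?_)
    have h1 : stateLin hf = stateLin hg := congrArg Subtype.val heq
    have h2 := congrFun (congrFun (LinearMap.congr_fun h1 x) (0 : Fin 1)) (0 : Fin 1)
    exact h2
  obtain ⟨n, a, ha, hpair⟩ := hK.separates hne'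
  refine hpair ?_
  ext p q
  refine h _ ((mem_lipschitz hK).2 ⟨1, one_pos, single (a p.2 q.2), ?_, 0, ?_⟩)
  · rw [single_apply_eq_sandwich]
    exact hK.absolutelyMatrixConvex.sandwich_mem (norm_row_le_one _ _) (norm_col_le_one _ _) ha
  · rw [Complex.ofReal_one, one_smul, left_eq_add]
    exact unitMat_zero

/-- Level-one density is applied to each entry with tolerance `ε / n²`, and the approximants are
reassembled by contractions, which preserve the span. -/
theorem exists_mem_lipschitz (hK : X.IsMatrixMetricSet K) {n : ℕ+} (a : Mat n A) {ε : ℝ}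
    (hε : 0 < ε) : ∃ v ∈ lipschitz hK n, X.matNorm (a - v) ≤ ε := by
  have hn : (0 : ℝ) < n := by exact_mod_cast n.pos
  have hδ : 0 < ε / (n * n) := by positivity
  have key : ∀ i j, ∃ v ∈ lipschitzOne hK, X.Bound (ε / (n * n)) (elt (a i j - v)) := fun i j =>
    exists_bound_sub (V := lipschitzOne hK)
      (fun v (hv : single v ∈ _) => conjTranspose_mem_lipschitz hK hv)
      ((mem_lipschitz hK).2 ⟨1, one_pos, 0, hK.absolutelyMatrixConvex.zero_mem hK.nonempty 1, 1, by
        ext k l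
        rw [Subsingleton.elim k l]
        simp only [smul_zero, zero_add, scalarMat, Matrix.map_apply, Matrix.one_apply_eq, one_smul]
        rfl⟩)
      (fun f hf g hg h => eq_of_eqOn_lipschitzOne hK hf hg h) (a i j) hδ
  choose v hv hb using key
  refine ⟨Matrix.of v, ?_, ?_⟩
  · rw [eq_sum_sandwich (Matrix.of v)]
    exact Submodule.sum_mem _ fun i _ => Submodule.sum_mem _ fun j _ =>
      sandwich_mem_lipschitz (norm_col_le_one _ _) (norm_row_le_one _ _) (hv i j)
  · have := bound_of_entries (X := X) (a := a - Matrix.of v) hδ.le hb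
    refine matNorm_le hε.le ?_
    convert this using 1
    rw [Fintype.card_fin]
    field_simp

end MatrixOrderUnitSpace
end MatrixMetric

/-! ### Finite nets, compactness and the three implications -/

namespace MatrixMetric
namespace MatrixOrderUnitSpace

variable {A : Type*} [AddCommGroup A] [Module ℂ A] [StarAddMonoid A] [StarModule ℂ A]
  {X : MatrixOrderUnitSpace A} {K : GradedSet A}

/-- `M_n(A)` as a normed group. -/
noncomputable abbrev normedGroup (X : MatrixOrderUnitSpace A) (n : ℕ+) : SeminormedAddCommGroup (Mat n A) :=
  AddGroupSeminorm.toSeminormedAddCommGroup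
    { toFun := X.matNorm
      map_zero' := matNorm_zero
      add_le' := matNorm_add_le
      neg' := matNorm_neg }

theorem normTopology_eq (X : MatrixOrderUnitSpace A) (n : ℕ+) :
    X.normTopology n = (X.normedGroup n).toUniformSpace.toTopologicalSpace := by
  let := X.normedGroup n
  refine TopologicalSpace.ext_iff.2 fun U => ?_
  rw [Metric.isOpen_iff]
  refine forall₂_congr fun a _ => exists_congr fun ε => and_congr_right fun _ => ?_
  refine forall_congr' fun b => ?_
  rw [Metric.mem_ball, dist_eq_norm]
  rfl

/-- Finite `ε`-nets for the matrix norm. -/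
def HasFiniteNets (X : MatrixOrderUnitSpace A) {n : ℕ+} (S : Set (Mat n A)) : Prop :=
  ∀ ε : ℝ, 0 < ε → ∃ t : Set (Mat n A), t.Finite ∧ ∀ a ∈ S, ∃ b ∈ t, X.matNorm (a - b) < ε

theorem totallyBounded_iff_hasFiniteNets {n : ℕ+} {S : Set (Mat n A)} :
    @TotallyBounded _ (X.normedGroup n).toUniformSpace S ↔ X.HasFiniteNets S := by
  let := X.normedGroup n
  rw [Metric.totallyBounded_iff]
  refine forall₂_congr fun ε _ => exists_congr fun t => and_congr_right fun _ => ?_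
  refine forall₂_congr fun a _ => ?_
  simp only [Set.mem_iUnion, Metric.mem_ball, exists_prop, dist_eq_norm]
  rfl

theorem hasFiniteNets_of_isCompact {n : ℕ+} {S : Set (Mat n A)}
    (hS : @IsCompact _ (X.normTopology n) S) : X.HasFiniteNets S := by
  rw [normTopology_eq] at hS
  let := X.normedGroup n
  exact totallyBounded_iff_hasFiniteNets.1 hS.totallyBounded

/-- The matrix norm dominates that of each entry and is controlled by `n²` times a common strict
bound on them, so Cauchy sequences converge entrywise and then in norm. -/
theorem completeSpace (hX : X.IsComplete) (n : ℕ+) :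
    @CompleteSpace _ (X.normedGroup n).toUniformSpace := by
  let := X.normedGroup n
  refine Metric.complete_of_cauchySeq_tendsto fun u hu => ?_
  have key : ∀ i j, ∃ a : A, ∀ ε : ℝ, 0 < ε → ∃ N : ℕ, ∀ m ≥ N,
      X.matNorm (single (u m i j - a)) < ε := fun i j =>
    hX (fun m => u m i j) fun ε hε => by
      obtain ⟨N, hN⟩ := Metric.cauchySeq_iff.1 hu ε hε
      refine ⟨N, fun k hk l hl => ?_⟩
      have h1 := hN k hk l hl
      rw [dist_eq_norm] at h1
      exact (matNorm_entry_le (u k - u l) i j).trans_lt h1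
  choose a ha using key
  refine ⟨Matrix.of a, Metric.tendsto_atTop.2 fun ε hε => ?_⟩
  have hn : (0 : ℝ) < n := by exact_mod_cast n.pos
  have hδ : 0 < ε / (2 * (n * n)) := by positivity
  choose N hN using fun i j => ha i j _ hδ
  refine ⟨∑ i, ∑ j, N i j, fun m hm => ?_⟩
  have hle : ∀ i j, N i j ≤ m := fun i j =>
    ((Finset.single_le_sum (f := fun j => N i j) (fun _ _ => Nat.zero_le _)
      (Finset.mem_univ j)).trans (Finset.single_le_sum (f := fun i => ∑ j, N i j)
        (fun _ _ => Nat.zero_le _) (Finset.mem_univ i))).trans hm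
  rw [dist_eq_norm]
  refine (matNorm_le_of_entries (X := X) (a := u m - Matrix.of a) hδ.le
    fun i j => hN i j m (hle i j)).trans_lt ?_
  have : (n : ℝ) * (n * (ε / (2 * (n * n)))) = ε / 2 := by field_simp
  rw [this]
  exact half_lt_self hε

theorem isCompact_closure_iff (hX : X.IsComplete) {n : ℕ+} {S : Set (Mat n A)} :
    @IsCompact _ (X.normTopology n) (@closure _ (X.normTopology n) S) ↔ X.HasFiniteNets S := by
  rw [normTopology_eq]
  let := X.normedGroup n
  have := completeSpace hX n
  rw [← totallyBounded_iff_hasFiniteNets, ← totallyBounded_closure]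
  exact ⟨fun h => h.totallyBounded, fun h => isCompact_iff_totallyBounded_isComplete.2 ⟨h, isClosed_closure.isComplete⟩⟩

theorem HasFiniteNets.exists_matNorm_le {n : ℕ+} {S : Set (Mat n A)} (h : X.HasFiniteNets S) :
    ∃ C : ℝ, ∀ a ∈ S, X.matNorm a ≤ C := by
  obtain ⟨t, ht, hS⟩ := h 1 one_pos
  obtain ⟨C, hC⟩ := (ht.image X.matNorm).bddAbove
  refine ⟨1 + C, fun a ha => ?_⟩
  obtain ⟨b, hb, hab⟩ := hS a ha
  have h1 := matNorm_add_le (X := X) (a - b) b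
  rw [sub_add_cancel] at h1
  linarith [hC (Set.mem_image_of_mem _ hb)]

theorem HasFiniteNets.exists_subset_add (hK : X.IsMatrixMetricSet K) {n : ℕ+} {S : Set (Mat n A)}
    (h : X.HasFiniteNets S) {ε : ℝ} (hε : 0 < ε) :
    ∃ lam : ℝ, 0 < lam ∧ S ⊆ X.closedBall ε n + (lam : ℂ) • K n + X.scalars n := by
  obtain ⟨t, ht, hS⟩ := h (ε / 2) (half_pos hε)
  choose v hv hvb using fun b : Mat n A => exists_mem_lipschitz hK b (half_pos hε)
  choose s hs k hk α hvk using fun b => (mem_lipschitz hK).1 (hv b)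
  obtain ⟨C, hC⟩ := (ht.image s).bddAbove
  -- `C` may fail to be positive when the net is empty.
  refine ⟨max C 1, by positivity, fun a ha => ?_⟩
  obtain ⟨b, hb, hab⟩ := hS a ha
  obtain ⟨w, hw, hkw⟩ := hK.absolutelyMatrixConvex.exists_smul_of_le (hk b) (hs b)
    ((hC (Set.mem_image_of_mem s hb)).trans (le_max_left C 1))
  have hsplit : a = (a - v b) + ((max C 1 : ℝ) : ℂ) • w + X.scalarMat (α b) := by
    rw [add_assoc, ← hkw, ← hvk, sub_add_cancel]
  rw [hsplit]
  refine Set.add_mem_add (Set.add_mem_add ?_ (Set.smul_mem_smul_set hw)) ⟨α b, rfl⟩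
  have h1 := matNorm_add_le (X := X) (a - b) (b - v b)
  rw [sub_add_sub_cancel] at h1
  have h2 := hvb b
  change X.matNorm _ ≤ ε
  linarith

theorem norm_pairing_sub_lt {r n : ℕ+} {φ ψ : X.CS r} {δ : ℝ}
    (h : X.stateDist K r φ ψ < ENNReal.ofReal δ) {a : Mat n A} (ha : a ∈ K n) :
    ‖pairing φ.1 a - pairing ψ.1 a‖ < δ := by
  have h1 : ENNReal.ofReal ‖pairing φ.1 a - pairing ψ.1 a‖ ≤ X.stateDist K r φ ψ :=
    le_iSup_of_le n (le_iSup₂_of_le a ha le_rfl)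
  exact (ENNReal.ofReal_lt_ofReal_iff_of_nonneg (norm_nonneg _)).1 (h1.trans_lt h)

theorem isBoundedFamily_hatSet {S : GradedSet A} {n : ℕ+} {C : ℝ}
    (hC : ∀ a ∈ S n, X.matNorm a ≤ C) : IsBoundedFamily (X.hatSet S n) := by
  refine ⟨max C 1, by positivity, ?_⟩
  rintro _ ⟨a, ha, rfl⟩ r φ
  exact (φ.2.norm_pairing_le a).trans ((hC a ha).trans (le_max_left _ _))

theorem isEquicontinuousFamily_hatSet {S : GradedSet A} {n : ℕ+}
    (h : ∀ ε : ℝ, 0 < ε → ∃ lam : ℝ, 0 < lam ∧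
      S n ⊆ X.closedBall ε n + (lam : ℂ) • K n + X.scalars n) :
    IsEquicontinuousFamily (X.stateDist K) (X.hatSet S n) := by
  intro ε hε r φ
  obtain ⟨lam, hlam, hS⟩ := h (ε / 3) (by positivity)
  -- The ball term costs `ε / 3` at each of the two states and the `K n` term at most `ε / 4`, less
  -- than `ε` in total.
  refine ⟨ε / (4 * lam), by positivity, ?_⟩
  rintro _ ⟨a, ha, rfl⟩ ψ hψ
  obtain ⟨_, ⟨x, hx, _, ⟨k, hk, rfl⟩, rfl⟩, _, ⟨α, rfl⟩, rfl⟩ := hS ha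
  have hx' : X.matNorm x ≤ ε / 3 := hx
  have h1 := (φ.2.norm_pairing_le x).trans hx'
  have h2 := (ψ.2.norm_pairing_le x).trans hx'
  have h3 := norm_pairing_sub_lt hψ hk
  have hsplit : X.hat (x + (lam : ℂ) • k + X.scalarMat α) r φ -
      X.hat (x + (lam : ℂ) • k + X.scalarMat α) r ψ =
        (pairing φ.1 x - pairing ψ.1 x) + (lam : ℂ) • (pairing φ.1 k - pairing ψ.1 k) := by
    simp only [hat, pairing_add, pairing_smul, φ.2.pairing_scalarMat ψ.2 α]
    module
  change ‖X.hat (x + (lam : ℂ) • k + X.scalarMat α) r φ -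
      X.hat (x + (lam : ℂ) • k + X.scalarMat α) r ψ‖ < ε
  rw [hsplit]
  have h4 : ‖(lam : ℂ) • (pairing φ.1 k - pairing ψ.1 k)‖ ≤ ε / 4 := by
    rw [norm_smul, Complex.norm_real, Real.norm_of_nonneg hlam.le]
    have := mul_le_mul_of_nonneg_left h3.le hlam.le
    have e : lam * (ε / (4 * lam)) = ε / 4 := by field_simp
    rwa [e] at this
  have h5 := norm_add_le (pairing φ.1 x - pairing ψ.1 x)
    ((lam : ℂ) • (pairing φ.1 k - pairing ψ.1 k))
  have h6 := norm_sub_le (pairing φ.1 x) (pairing ψ.1 x)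
  linarith

/-- Tychonoff: contractivity confines each value `f x` to a closed disc, and the defining conditions
are closed under pointwise convergence. -/
theorem isCompact_stateSet : IsCompact X.stateSet := by
  refine (isCompact_univ_pi fun x : A =>
    isCompact_closedBall (0 : ℂ) (X.matNorm (single x))).of_isClosed_subset ?_ ?_
  · simp only [stateSet, Set.ofPred_and, Set.ofPred_forall, Complex.nonneg_iff]
    refine (isClosed_iInter fun x => isClosed_iInter fun y => isClosed_eq ?_ ?_).inter
      ((isClosed_iInter fun c => isClosed_iInter fun x => isClosed_eq ?_ ?_).inter
        ((isClosed_eq ?_ ?_).inter (isClosed_iInter fun x => isClosed_iInter fun _ =>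
          (isClosed_le ?_ ?_).inter (isClosed_eq ?_ ?_)))) <;> fun_prop
  · intro f hf x _
    simpa using norm_apply_le_matNorm hf x

theorem apply_sub_of_mem_stateSet {f : A → ℂ} (hf : f ∈ X.stateSet) (x y : A) :
    f (x - y) = f x - f y := by
  have h : f (-y) = -f y := by simpa using hf.2.1 (-1) y
  rw [sub_eq_add_neg, hf.1, h, sub_eq_add_neg]

/-- Closeness at a finite `δ / 4`-net of `K 1` forces closeness within `3 δ / 4` on all of `K 1`,
and `norm_pairing_sub_le` extends this to every `K n`. -/
theorem exists_mem_nhds_stateDist_lt (hK : X.IsMatrixMetricSet K) {f : A → ℂ}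
    (hf : f ∈ X.stateSet) {δ : ℝ} (hδ : 0 < δ) : ∃ U ∈ nhds f, ∀ g (hg : g ∈ X.stateSet), g ∈ U →
      X.stateDist K 1 (stateOf hf) (stateOf hg) < ENNReal.ofReal δ := by
  obtain ⟨t, ht, hnet⟩ := hasFiniteNets_of_isCompact (hK.normCompact 1) (δ / 4) (by positivity)
  refine ⟨⋂ b ∈ t, {g | ‖f (b 0 0) - g (b 0 0)‖ < δ / 4}, ?_, fun g hg hgU => ?_⟩
  · refine (Filter.biInter_mem ht).2 fun b _ => IsOpen.mem_nhds ?_ (by simpa using by positivity)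
    exact isOpen_lt (by fun_prop) continuous_const
  · have hx : ∀ x, single x ∈ K 1 → ‖f x - g x‖ ≤ 3 * (δ / 4) := by
      intro x hx
      obtain ⟨b, hb, hxb⟩ := hnet _ hx
      have h1 : ‖f (b 0 0) - g (b 0 0)‖ < δ / 4 := Set.mem_iInter₂.1 hgU b hb
      have h2 : X.matNorm (single (x - b 0 0)) < δ / 4 :=
        (matNorm_entry_le (single x - b) 0 0).trans_lt hxb
      have h3 := (norm_apply_le_matNorm hf (x - b 0 0)).trans_lt h2
      have h4 := (norm_apply_le_matNorm hg (x - b 0 0)).trans_lt h2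
      rw [apply_sub_of_mem_stateSet hf] at h3
      rw [apply_sub_of_mem_stateSet hg] at h4
      have h5 : f x - g x = (f x - f (b 0 0)) + (f (b 0 0) - g (b 0 0)) - (g x - g (b 0 0)) := by
        ring
      rw [h5]
      linarith [norm_sub_le ((f x - f (b 0 0)) + (f (b 0 0) - g (b 0 0))) (g x - g (b 0 0)),
        norm_add_le (f x - f (b 0 0)) (f (b 0 0) - g (b 0 0))]
    have hle : X.stateDist K 1 (stateOf hf) (stateOf hg) ≤ ENNReal.ofReal (3 * (δ / 4)) :=
      iSup_le fun n => iSup₂_le fun a ha => ENNReal.ofReal_le_ofReal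
        (norm_pairing_sub_le hK.absolutelyMatrixConvex hf hg (by positivity) hx ha)
    refine hle.trans_lt ((ENNReal.ofReal_lt_ofReal_iff hδ).2 (by linarith))

theorem hasFiniteNets_of_isEquicontinuousFamily (hK : X.IsMatrixMetricSet K) {S : GradedSet A}
    {n : ℕ+} (hb : IsBoundedFamily (X.hatSet S n))
    (he : IsEquicontinuousFamily (X.stateDist K) (X.hatSet S n)) : X.HasFiniteNets (S n) := by
  intro ε hε
  have hn : (0 : ℝ) < n := by exact_mod_cast n.pos
  -- State values will differ by at most `3 η < 4 η`, so the norm is at most `n² (4 η + 4 η) = ε /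
  -- 2`.
  set η : ℝ := ε / (16 * (n * n)) with hη
  have hη0 : 0 < η := by positivity
  obtain ⟨C, hC, hbd⟩ := hb
  have hloc : ∀ f (hf : f ∈ X.stateSet), ∃ U ∈ nhds f, ∀ g (_ : g ∈ X.stateSet), g ∈ U →
      ∀ a ∈ S n, ∀ i j, ‖f (a i j) - g (a i j)‖ < η := by
    intro f hf
    obtain ⟨δ, hδ, h⟩ := he η hη0 1 (stateOf hf)
    obtain ⟨U, hU, hUd⟩ := exists_mem_nhds_stateDist_lt hK hf hδ
    refine ⟨U, hU, fun g hg hgU a ha i j => ?_⟩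
    exact (norm_entry_le_l2_opNorm (X.hat a 1 (stateOf hf) - X.hat a 1 (stateOf hg))
      ((0 : Fin 1), i) ((0 : Fin 1), j)).trans_lt (h _ ⟨a, ha, rfl⟩ _ (hUd g hg hgU))
  choose! U hU hUη using hloc
  obtain ⟨t, ht⟩ := isCompact_stateSet.elim_nhds_subcover' (fun f _ => U f) hU
  -- Sampling at the centres of the finite subcover puts the problem in a finite-dimensional space,
  -- where bounded sets are totally bounded.
  let Φ : Mat n A → (t → Fin n → Fin n → ℂ) := fun a f i j => f.1.1 (a i j)
  have hΦ : TotallyBounded (Φ '' S n) := by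
    refine (Bornology.IsBounded.isCompact_closure ?_).totallyBounded.subset subset_closure
    refine (Metric.isBounded_closedBall (x := 0) (r := C)).subset ?_
    rintro _ ⟨a, ha, rfl⟩
    rw [mem_closedBall_zero_iff]
    refine (pi_norm_le_iff_of_nonneg hC.le).2 fun f => (pi_norm_le_iff_of_nonneg hC.le).2 fun i =>
      (pi_norm_le_iff_of_nonneg hC.le).2 fun j => ?_
    exact (norm_apply_le f.1.2 a i j).trans (hbd _ ⟨a, ha, rfl⟩ 1 (stateOf f.1.2))
  -- The net is chosen inside `S n`, because the equicontinuity estimate is also applied to its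
  -- points.
  obtain ⟨s, hsS, hs, hcov⟩ := Set.exists_subset_image_finite_and.1
    (Metric.finite_approx_of_totallyBounded hΦ η hη0)
  refine ⟨s, hs, fun a ha => ?_⟩
  obtain ⟨_, ⟨b, hb, rfl⟩, hab⟩ := Set.mem_iUnion₂.1 (hcov ⟨a, ha, rfl⟩)
  refine ⟨b, hb, ?_⟩
  have hclose : ∀ f ∈ X.stateSet, ∀ i j, ‖f ((a - b) i j)‖ ≤ 3 * η := by
    intro g hg i j
    obtain ⟨f, hft, hgf⟩ := Set.mem_iUnion₂.1 (ht hg)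
    have h1 := hUη f.1 f.2 g hg hgf a ha i j
    have h2 := hUη f.1 f.2 g hg hgf b (hsS hb) i j
    have h3 : ‖f.1 (a i j) - f.1 (b i j)‖ < η := by
      rw [Metric.mem_ball, dist_eq_norm] at hab
      exact ((norm_le_pi_norm _ j).trans ((norm_le_pi_norm _ i).trans
        (norm_le_pi_norm (Φ a - Φ b) ⟨f, hft⟩))).trans_lt hab
    rw [Matrix.sub_apply, apply_sub_of_mem_stateSet hg]
    have h5 : g (a i j) - g (b i j) = (f.1 (a i j) - f.1 (b i j)) - (f.1 (a i j) - g (a i j)) +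
        (f.1 (b i j) - g (b i j)) := by ring
    rw [h5]
    linarith [norm_add_le ((f.1 (a i j) - f.1 (b i j)) - (f.1 (a i j) - g (a i j)))
      (f.1 (b i j) - g (b i j)), norm_sub_le (f.1 (a i j) - f.1 (b i j)) (f.1 (a i j) - g (a i j))]
  refine (matNorm_le_of_forall_state (X := X) (by positivity) (by linarith : 3 * η < 4 * η)
    hclose).trans_lt ?_
  have : (n : ℝ) * (n * (4 * η + 4 * η)) = ε / 2 := by
    rw [hη]
    field_simp
    norm_num
  rw [this]
  exact half_lt_self hε

end MatrixOrderUnitSpace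
end MatrixMetric

theorem theorem5p4 {A : Type*} [AddCommGroup A] [Module ℂ A] [StarAddMonoid A] [StarModule ℂ A]
    (X : MatrixMetric.MatrixOrderUnitSpace A) (hX : X.IsComplete)
    (K : MatrixMetric.GradedSet A) (hK : X.IsMatrixMetricSet K)
    (S : MatrixMetric.GradedSet A) :
    List.TFAE [
      X.IsNormRelativelyCompact S,
      ∀ n : ℕ+, MatrixMetric.IsBoundedFamily (X.hatSet S n) ∧
        MatrixMetric.IsEquicontinuousFamily (X.stateDist K) (X.hatSet S n),
      X.IsNormBounded S ∧
        ∀ ε : ℝ, 0 < ε → ∃ lam : ℕ+ → ℝ, (∀ n, 0 < lam n) ∧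
          ∀ n : ℕ+, S n ⊆ X.closedBall ε n + (lam n : ℂ) • K n + X.scalars n] := by
  tfae_have 1 → 3 := fun h => by
    have hnet : ∀ n, X.HasFiniteNets (S n) := fun n =>
      (MatrixMetric.MatrixOrderUnitSpace.isCompact_closure_iff hX).1 (h n)
    refine ⟨fun n => (hnet n).exists_matNorm_le, fun ε hε => ?_⟩
    choose lam hlam hS using fun n => (hnet n).exists_subset_add hK hε
    exact ⟨lam, hlam, hS⟩
  tfae_have 3 → 2 := fun ⟨hb, h⟩ n => by
    obtain ⟨C, hC⟩ := hb n
    refine ⟨MatrixMetric.MatrixOrderUnitSpace.isBoundedFamily_hatSet hC,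
      MatrixMetric.MatrixOrderUnitSpace.isEquicontinuousFamily_hatSet fun ε hε => ?_⟩
    obtain ⟨lam, hlam, hS⟩ := h ε hε
    exact ⟨lam n, hlam n, hS n⟩
  tfae_have 2 → 1 := fun h n =>
    (MatrixMetric.MatrixOrderUnitSpace.isCompact_closure_iff hX).2
      (MatrixMetric.MatrixOrderUnitSpace.hasFiniteNets_of_isEquicontinuousFamily hK
        (h n).1 (h n).2)
  tfae_finish
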